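/- Let $\alpha\in(0,1)$. For $a\in(-1,1)$ put $\mu_{1,a}=2^{a}\pi^{-1/2}\,\Gamma\big(\tfrac{a+2}{2}\big)/\Gamma\big(\tfrac{1-a}{2}\big)$. For $\varphi\in C_c^\infty(\mathbb R)$ let $$\operatorname{div}^\alpha\varphi(x)=\mu_{1,\alpha}\int_{\mathbb R}\frac{(y-x)(\varphi(y)-\varphi(x))}{|y-x|^{\alpha+2}}\,dy .$$ For $p\in[1,+\infty]$, $BV^{\alpha,p}(\mathbb R)$ is the set of $f\in L^p(\mathbb R)$ with $$|D^\alpha f|(\mathbb R)=\sup\Big\{\int_{\mathbb R} f\operatorname{div}^\alpha\varphi\,dx:\ \varphi\in C_c^\infty(\mathbb R),\ \|\varphi\|_{L^\infty}\le1\Big\}<+\infty ,$$ and a finite signed Radon measure $\mu$ on $\mathbb R$ is the fractional derivative $D^\alpha f$ if $\int_{\mathbb R} f\operatorname{div}^\alpha\varphi\,dx=-\int_{\mathbb R}\varphi\,d\mu$ for all $\varphi\in C_c^\infty(\mathbb R)$. Let $$f_\alpha(x)=\mu_{1,-\alpha}\big(|x|^{\alpha-1}\operatorname{sgn}x-|x-1|^{\alpha-1}\operatorname{sgn}(x-1)\big),\qquad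 x\in\mathbb R,$$ for which $D^\alpha f_\alpha=\delta_0-\delta_1$. Let $\nu$ be a finite signed Radon measure on $\mathbb R$, with total variation measure $|\nu|$, and let $$u_\alpha(x)=(f_\alpha*\nu)(x)=\int_{\mathbb R}f_\alpha(x-y)\,d\nu(y),$$ where the integral converges absolutely for a.e. $x\in\mathbb R$. Then $$u_\alpha\in BV^{\alpha,p}(\mathbb R)\quad\text{for all } p\in\Big[1,\tfrac1{1-\alpha}\Big),\qquad D^\alpha u_\alpha=\nu-(\tau_1)_\#\nu,$$ where $\tau_1(y)=y+1$. If moreover there are $C,\varepsilon>0$ such that $|\nu|\big((x-r,x+r)\big)\le Cr^\varepsilon$ for all $x\in\mathbb R$ and $r>0$, then $$u_\alpha\in BV^{\alpha,p}(\mathbb R)\quad\text{for all}\quad p\in\begin{cases}\big[1,\frac{1-\varepsilon}{1-\alpha-\varepsilon}\big)&\text{if }\varepsilon\in(0,1-\alpha),\\[1mm] [1,+\infty)&\text{if }\varepsilon=1-\alpha,\\[1mm] [1,+\infty]&\text{if }\varepsilon\in(1-\alpha,1].\end{cases}$$ -/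

import Mathlib

open MeasureTheory
open scoped ENNReal ContDiff

noncomputable section

namespace FracBV

/-- The renormalizing constant `μ_{n,a} = 2^a π^{-n/2} Γ((n+a+1)/2) / Γ((1-a)/2)`. -/
def fracConst (n : ℕ) (a : ℝ) : ℝ :=
  (2 : ℝ) ^ a * Real.pi ^ (-(n : ℝ) / 2) * Real.Gamma (((n : ℝ) + a + 1) / 2)
    / Real.Gamma ((1 - a) / 2)

/-- The fractional divergence of order `α` on the real line,
`div^α φ (x) = μ_{1,α} ∫ (y - x) (φ(y) - φ(x)) / |y - x|^{α+2} dy`.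
For `α ∈ (0,1)` and `φ` a test function the integral converges absolutely. -/
def fracDiv (α : ℝ) (φ : ℝ → ℝ) (x : ℝ) : ℝ :=
  fracConst 1 α * ∫ y, (y - x) * (φ y - φ x) / |y - x| ^ (α + 2)

/-- The class `C_c^∞(ℝ)`. -/
structure IsTestFunction (φ : ℝ → ℝ) : Prop where
  contDiff : ContDiff ℝ ∞ φ
  hasCompactSupport : HasCompactSupport φ

/-- The total fractional variation `|D^α f|(ℝ)`: the supremum of `∫ f div^α φ dx` over
`φ ∈ C_c^∞(ℝ)` with `‖φ‖_∞ ≤ 1`. -/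
def fracVariation (α : ℝ) (f : ℝ → ℝ) : EReal :=
  ⨆ φ : {φ : ℝ → ℝ // IsTestFunction φ ∧ ∀ x, |φ x| ≤ 1},
    ((∫ x, f x * fracDiv α φ.1 x : ℝ) : EReal)

/-- Membership in `BV^{α,p}(ℝ)`: `f ∈ L^p(ℝ)` and `|D^α f|(ℝ) < ∞`. -/
def MemBV (α : ℝ) (p : ℝ≥0∞) (f : ℝ → ℝ) : Prop :=
  MemLp f p volume ∧ fracVariation α f < ⊤

/-- The finite signed Radon measure `μ` is the fractional derivative `D^α f`, that is
`∫ f div^α φ dx = - ∫ φ dμ` for all `φ ∈ C_c^∞(ℝ)`. -/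
def IsFracDeriv (α : ℝ) (f : ℝ → ℝ) (μ : SignedMeasure ℝ) : Prop :=
  ∀ φ : ℝ → ℝ, IsTestFunction φ → ∫ x, f x * fracDiv α φ x = - ∫ᵛ x, φ x ∂•μ

/-- The function
`f_α(x) = μ_{1,-α} (|x|^{α-1} sgn x - |x-1|^{α-1} sgn (x-1))`. -/
def fAlpha (α : ℝ) (x : ℝ) : ℝ :=
  fracConst 1 (-α) * (|x| ^ (α - 1) * Real.sign x - |x - 1| ^ (α - 1) * Real.sign (x - 1))

/-- The convolution `u_α = f_α * ν`, `u_α(x) = ∫ f_α(x - y) dν(y)`. -/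
def uAlpha (α : ℝ) (ν : SignedMeasure ℝ) (x : ℝ) : ℝ :=
  ∫ᵛ y, fAlpha α (x - y) ∂•ν

end FracBV

end

namespace FracBV

open Set ProbabilityTheory Filter Topology

/-! Everything rests on one duality identity: the kernel `oddPow α`, that is `sgn x |x|^(α-1)`,
inverts the fractional divergence up to a constant, so that pairing a translate of `f_α` by `z` with
`div^α φ` gives `φ (z + 1) - φ z` (`integral_fAlpha_sub_mul_fracDiv`). Integrating in `z` against
`ν` and using Fubini, which is legitimate because `f_α` is integrable and `div^α φ` is bounded,
gives `D^α u_α = ν - (τ_1)_# ν`. The same formula bounds the fractional variation, since `|φ (z + 1)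
- φ z| ≤ 2`.

For the inversion, `div^α φ` is a multiple of `φ'` convolved with `|h|^(-α)` (`divKernel_eq`).
Convolving that kernel with `oddPow α` is only conditionally convergent, so the exponent `α` of
`oddPow` is lowered to `a < α`. The convolution then converges absolutely and, by homogeneity, is a
constant times `sgn y |y|^(a-α)`. As `a ↑ α` the kernel tends to `sgn y`, whose derivative is `2δ₀`.
The constant is a sum of Beta functions in which two poles cancel, leaving `π tan (πα/2)`; the Gamma
reflection formula shows that the normalisations `μ_{1,±α}` compensate for it.

For integrability, `f_α` behaves like `|z|^(α-1)` near its two singularities and like `|z|^(α-2)` at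
infinity. A Hölder inequality with weight `1 + |z|^(-σ) + |z-1|^(-σ)` gives `u_α ∈ L^p` as soon as
`∫ |x-y|^(-σ) d|ν|(y)` is bounded in `x` and `(1-α)p - σ(p-1) < 1`. Without further hypotheses `σ =
0` is available; the growth condition allows every `σ < ε` by a dyadic decomposition. Each range of
finite `p` comes from solving this inequality, and `p = ∞` is the direct bound with `σ = 1 - α < ε`.
-/

/-! ### Beta integrals and the constant of the kernel -/

/-- The Beta density has total mass one; both the integrability and the value are read off from this
normalisation. -/
theorem integrableOn_Ioo_rpow_mul_one_sub_rpow {a c : ℝ} (ha : 0 < a) (hc : 0 < c) :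
    IntegrableOn (fun t : ℝ => t ^ (a - 1) * (1 - t) ^ (c - 1)) (Ioo 0 1) ∧
      ∫ t in Ioo (0 : ℝ) 1, t ^ (a - 1) * (1 - t) ^ (c - 1) = beta a c := by
  have hB := beta_pos ha hc
  have h1 := lintegral_betaPDF_eq_one ha hc
  rw [lintegral_betaPDF] at h1
  have hpos : ∀ t ∈ Ioo (0 : ℝ) 1, 0 ≤ 1 / beta a c * t ^ (a - 1) * (1 - t) ^ (c - 1) := by
    intro t ht
    have := ht.1
    have : 0 < 1 - t := sub_pos.2 ht.2
    positivity
  have hi : IntegrableOn (fun t : ℝ => 1 / beta a c * t ^ (a - 1) * (1 - t) ^ (c - 1))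
      (Ioo 0 1) := by
    refine ⟨by fun_prop, ?_⟩
    rw [hasFiniteIntegral_iff_ofReal (ae_restrict_of_forall_mem measurableSet_Ioo hpos), h1]
    exact ENNReal.one_lt_top
  have hv : ∫ t in Ioo (0 : ℝ) 1, 1 / beta a c * t ^ (a - 1) * (1 - t) ^ (c - 1) = 1 := by
    rw [integral_eq_lintegral_of_nonneg_ae (ae_restrict_of_forall_mem measurableSet_Ioo hpos)
      hi.aestronglyMeasurable, h1, ENNReal.toReal_one]
  have he : (fun t : ℝ => t ^ (a - 1) * (1 - t) ^ (c - 1)) =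
      fun t => beta a c * (1 / beta a c * t ^ (a - 1) * (1 - t) ^ (c - 1)) := by
    ext t; field_simp
  constructor
  · rw [he]; exact hi.const_mul _
  · rw [he, integral_const_mul, hv, mul_one]

theorem image_div_one_sub_Ioo : (fun s : ℝ => s / (1 - s)) '' Ioo 0 1 = Ioi 0 := by
  ext t
  simp only [mem_image, mem_Ioo, mem_Ioi]
  constructor
  · rintro ⟨s, ⟨h0, h1⟩, rfl⟩
    exact div_pos h0 (by linarith)
  · intro ht
    refine ⟨t / (1 + t), ⟨by positivity, by rw [div_lt_one (by positivity)]; linarith⟩, ?_⟩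
    have : 1 + t ≠ 0 := by positivity
    field_simp
    ring

/-- The substitution `t = s / (1 - s)` turns this into the Beta integral on the unit interval. -/
theorem integrableOn_Ioi_rpow_mul_one_add_rpow {a c : ℝ} (ha : 0 < a) (hc : 0 < c) :
    IntegrableOn (fun t : ℝ => t ^ (a - 1) * (1 + t) ^ (-(a + c))) (Ioi 0) ∧
      ∫ t in Ioi (0 : ℝ), t ^ (a - 1) * (1 + t) ^ (-(a + c)) = beta a c := by
  obtain ⟨hi, hv⟩ := integrableOn_Ioo_rpow_mul_one_sub_rpow ha hc
  have hd : ∀ s ∈ Ioo (0 : ℝ) 1,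
      HasDerivWithinAt (fun s : ℝ => s / (1 - s)) (1 / (1 - s) ^ 2) (Ioo 0 1) s := by
    intro s hs
    have hs1 : (1 - s) ≠ 0 := (sub_pos.2 hs.2).ne'
    refine ((hasDerivAt_id' s).fun_div ((hasDerivAt_id' s).const_sub 1)
      hs1).hasDerivWithinAt.congr_deriv ?_
    ring
  have hinj : InjOn (fun s : ℝ => s / (1 - s)) (Ioo 0 1) := by
    intro s hs t ht h
    have hs1 : (1 - s) ≠ 0 := (sub_pos.2 hs.2).ne'
    have ht1 : (1 - t) ≠ 0 := (sub_pos.2 ht.2).ne'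
    simp only at h
    rw [div_eq_div_iff hs1 ht1] at h
    linarith
  have hc' : EqOn (fun s : ℝ => |1 / (1 - s) ^ 2| •
      ((s / (1 - s)) ^ (a - 1) * (1 + s / (1 - s)) ^ (-(a + c))))
      (fun s : ℝ => s ^ (a - 1) * (1 - s) ^ (c - 1)) (Ioo 0 1) := by
    intro s hs
    have h1 : 0 < 1 - s := sub_pos.2 hs.2
    have h2 : 1 + s / (1 - s) = (1 - s)⁻¹ := by field_simp; ring
    simp only [smul_eq_mul]
    rw [h2, Real.div_rpow hs.1.le h1.le, Real.inv_rpow h1.le, ← Real.rpow_neg h1.le, neg_neg,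
      abs_of_pos (by positivity : 0 < 1 / (1 - s) ^ 2), one_div, div_eq_mul_inv,
      ← Real.rpow_natCast,
      ← Real.rpow_neg h1.le, ← Real.rpow_neg h1.le]
    calc _ = s ^ (a - 1) *
          ((1 - s) ^ (-((2 : ℕ) : ℝ)) * (1 - s) ^ (-(a - 1)) * (1 - s) ^ (a + c)) := by
          ring
      _ = _ := by
          rw [← Real.rpow_add h1, ← Real.rpow_add h1]
          congr 2
          push_cast
          ring
  constructor
  · rw [← image_div_one_sub_Ioo,
      integrableOn_image_iff_integrableOn_abs_deriv_smul measurableSet_Ioo hd hinj]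
    exact hi.congr_fun hc'.symm measurableSet_Ioo
  · rw [← image_div_one_sub_Ioo,
      integral_image_eq_integral_abs_deriv_smul measurableSet_Ioo hd hinj,
      setIntegral_congr_fun measurableSet_Ioo hc', hv]

/-- `sgn(x) |x|^(a-1)`, the unnormalised kernel of the Riesz-type potential. -/
noncomputable def oddPow (a x : ℝ) : ℝ := |x| ^ (a - 1) * Real.sign x

theorem measurable_sign : Measurable Real.sign := by
  unfold Real.sign
  exact Measurable.ite measurableSet_Iio measurable_const
    (Measurable.ite measurableSet_Ioi measurable_const measurable_const)

@[fun_prop]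
theorem measurable_oddPow (a : ℝ) : Measurable (oddPow a) := by
  unfold oddPow
  exact (by fun_prop : Measurable fun x : ℝ => |x| ^ (a - 1)).mul measurable_sign

theorem abs_oddPow_le (a x : ℝ) : |oddPow a x| ≤ |x| ^ (a - 1) := by
  unfold oddPow
  rw [abs_mul, abs_of_nonneg (by positivity : (0 : ℝ) ≤ |x| ^ (a - 1))]
  refine mul_le_of_le_one_right (by positivity) ?_
  rcases Real.sign_apply_eq x with h | h | h <;> simp [h]

/-- The line is cut at the singularities `0` and `1`; translation and reflection turn the three
pieces into Beta integrals, the negative half-line entering with a minus sign. The assumption `a <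
b` is what gives integrability at infinity. -/
theorem integral_oddPow_mul_rpow {a b : ℝ} (ha : 0 < a) (hab : a < b) (hb : b < 1) :
    Integrable (fun t : ℝ => oddPow a t * |1 - t| ^ (-b)) ∧
      ∫ t, oddPow a t * |1 - t| ^ (-b) =
        beta a (1 - b) + beta (1 - b) (b - a) - beta a (b - a) := by
  set F : ℝ → ℝ := fun t => oddPow a t * |1 - t| ^ (-b) with hF
  obtain ⟨i1, v1⟩ := integrableOn_Ioo_rpow_mul_one_sub_rpow ha (sub_pos.2 hb)
  obtain ⟨i2, v2⟩ := integrableOn_Ioi_rpow_mul_one_add_rpow (sub_pos.2 hb) (sub_pos.2 hab)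
  obtain ⟨i3, v3⟩ := integrableOn_Ioi_rpow_mul_one_add_rpow ha (sub_pos.2 hab)
  have e1 : EqOn (fun t : ℝ => t ^ (a - 1) * (1 - t) ^ (1 - b - 1)) F (Ioo 0 1) := by
    intro t ht
    simp only [hF, oddPow]
    rw [Real.sign_of_pos ht.1, abs_of_pos ht.1, abs_of_pos (sub_pos.2 ht.2)]
    ring_nf
  have e2 : EqOn (fun t : ℝ => t ^ (1 - b - 1) * (1 + t) ^ (-(1 - b + (b - a))))
      (fun t => F (t + 1)) (Ioi 0) := by
    intro t ht
    have ht' : 0 < t := ht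
    simp only [hF, oddPow]
    rw [Real.sign_of_pos (by linarith), abs_of_pos (by linarith),
      show |1 - (t + 1)| = t by rw [show 1 - (t + 1) = -t by ring, abs_neg, abs_of_pos ht']]
    ring_nf
  have e3 : EqOn (fun t : ℝ => -(t ^ (a - 1) * (1 + t) ^ (-(a + (b - a)))))
      (fun t => F (-t)) (Ioi 0) := by
    intro t ht
    have ht' : 0 < t := ht
    simp only [hF, oddPow]
    rw [Real.sign_of_neg (by linarith), abs_neg, abs_of_pos ht', sub_neg_eq_add,
      abs_of_pos (by linarith)]
    ring_nf
  have I1 : IntegrableOn F (Ioo 0 1) := i1.congr_fun e1 measurableSet_Ioo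
  have p2 : (fun t : ℝ => t + 1) ⁻¹' Ioi 1 = Ioi 0 := by
    ext t; simp
  have p3 : (fun t : ℝ => -t) ⁻¹' Iio 0 = Ioi 0 := by
    ext t; simp
  have m2 := measurePreserving_add_right (volume : Measure ℝ) 1
  have n2 := measurableEmbedding_addRight (1 : ℝ)
  have m3 := Measure.measurePreserving_neg (volume : Measure ℝ)
  have n3 := (MeasurableEquiv.neg ℝ).measurableEmbedding
  have I2 : IntegrableOn F (Ioi 1) := by
    rw [← m2.integrableOn_comp_preimage n2, p2]
    exact i2.congr_fun e2 measurableSet_Ioi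
  have I3 : IntegrableOn F (Iio 0) := by
    rw [← m3.integrableOn_comp_preimage n3, p3]
    exact i3.neg.congr_fun e3 measurableSet_Ioi
  have V1 : ∫ t in Ioo 0 1, F t = beta a (1 - b) := by
    rw [← v1, setIntegral_congr_fun measurableSet_Ioo e1]
  have V2 : ∫ t in Ioi 1, F t = beta (1 - b) (b - a) := by
    rw [← v2, setIntegral_congr_fun measurableSet_Ioi e2, ← m2.setIntegral_preimage_emb n2, p2]
  have V3 : ∫ t in Iio 0, F t = - beta a (b - a) := by
    rw [← v3, ← integral_neg, setIntegral_congr_fun measurableSet_Ioi e3,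
      ← m3.setIntegral_preimage_emb n3, p3]
  have J2 : IntegrableOn F (Ici 1) := by rwa [integrableOn_Ici_iff_integrableOn_Ioi]
  have J1 : IntegrableOn F (Ico 0 1) := by rwa [integrableOn_Ico_iff_integrableOn_Ioo]
  have J0 : IntegrableOn F (Ici 0) := by
    rw [← Ico_union_Ici_eq_Ici zero_le_one]; exact J1.union J2
  constructor
  · rw [← integrableOn_univ, ← Iio_union_Ici (a := (0 : ℝ))]
    exact I3.union J0
  · change ∫ t, F t = _
    rw [← setIntegral_univ, ← Iio_union_Ici (a := (0 : ℝ)),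
      setIntegral_union (Iio_disjoint_Ici le_rfl) measurableSet_Ici I3 J0,
      ← Ico_union_Ici_eq_Ici zero_le_one,
      setIntegral_union (Set.disjoint_left.2 fun x hx hx' => hx.2.not_ge hx')
        measurableSet_Ici J1 J2,
      integral_Ico_eq_integral_Ioo, integral_Ici_eq_integral_Ioi, V1, V2, V3]
    ring

theorem hasDerivAt_pi_div_sin {s : ℝ} (hs : s ∈ Ioo (0 : ℝ) 1) :
    HasDerivAt (fun s => Real.pi / Real.sin (Real.pi * s))
      (-(Real.pi ^ 2 * Real.cos (Real.pi * s)) / Real.sin (Real.pi * s) ^ 2) s := by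
  have h0 : Real.sin (Real.pi * s) ≠ 0 :=
    (Real.sin_pos_of_pos_of_lt_pi (mul_pos Real.pi_pos hs.1)
      (by nlinarith [Real.pi_pos, hs.2])).ne'
  refine ((hasDerivAt_const s Real.pi).fun_div
    ((hasDerivAt_id' s).const_mul Real.pi).sin h0).congr_deriv ?_
  ring

/-- The last two Beta values share the factor `Γ(b-a)`, which has a pole at `a = b`. By the
reflection formula it multiplies a difference of values of `π / sin (πs)`, so absorbing `b - a` into
the Gamma factor leaves a difference quotient with a finite limit. -/
theorem beta_combination_eq {a b : ℝ} (ha : 0 < a) (hab : a < b) (hb : b < 1) :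
    beta a (1 - b) + beta (1 - b) (b - a) - beta a (b - a) =
      beta a (1 - b) + Real.Gamma (1 + (b - a)) / (Real.Gamma (1 - a) * Real.Gamma b) *
        slope (fun s => Real.pi / Real.sin (Real.pi * s)) b a := by
  have hG : Real.Gamma (1 + (b - a)) = (b - a) * Real.Gamma (b - a) := by
    rw [add_comm, Real.Gamma_add_one (sub_pos.2 hab).ne']
  have h1 := (Real.Gamma_pos_of_pos (by linarith : 0 < 1 - a)).ne'
  have h2 := (Real.Gamma_pos_of_pos (by linarith : 0 < b)).ne'
  have h3 : a - b ≠ 0 := by linarith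
  rw [slope_def_field, ← Real.Gamma_mul_Gamma_one_sub, ← Real.Gamma_mul_Gamma_one_sub, hG]
  unfold beta
  rw [show 1 - b + (b - a) = 1 - a by ring, show a + (b - a) = b by ring]
  field_simp
  ring

theorem tendsto_integral_oddPow {b : ℝ} (hb : b ∈ Ioo (0 : ℝ) 1) :
    Tendsto (fun a => ∫ t, oddPow a t * |1 - t| ^ (-b)) (𝓝[<] b)
      (𝓝 (Real.pi * Real.tan (Real.pi * b / 2))) := by
  have hev : ∀ᶠ a in 𝓝[<] b, a ∈ Ioo 0 b := Ioo_mem_nhdsLT hb.1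
  have hlim : Tendsto (fun a => beta a (1 - b) +
      Real.Gamma (1 + (b - a)) / (Real.Gamma (1 - a) * Real.Gamma b) *
        slope (fun s => Real.pi / Real.sin (Real.pi * s)) b a) (𝓝[<] b)
      (𝓝 (beta b (1 - b) + Real.Gamma (1 + (b - b)) / (Real.Gamma (1 - b) * Real.Gamma b) *
        (-(Real.pi ^ 2 * Real.cos (Real.pi * b)) / Real.sin (Real.pi * b) ^ 2))) := by
    have hGc : ∀ {s : ℝ}, 0 < s → ContinuousAt Real.Gamma s := fun {s} hs =>
      (Real.differentiableAt_Gamma fun m => by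
        have : (0 : ℝ) ≤ m := m.cast_nonneg
        linarith).continuousAt
    have c1 : ContinuousAt (fun a => beta a (1 - b)) b := by
      unfold beta
      refine ((hGc hb.1).mul continuousAt_const).div
        (ContinuousAt.comp (g := Real.Gamma) (hGc ?_) (by fun_prop)) ?_
      · linarith
      · rw [show b + (1 - b) = 1 by ring, Real.Gamma_one]; exact one_ne_zero
    have c2 : ContinuousAt (fun a => Real.Gamma (1 + (b - a)) /
        (Real.Gamma (1 - a) * Real.Gamma b)) b := by
      refine ContinuousAt.div (ContinuousAt.comp (g := Real.Gamma) (hGc ?_) (by fun_prop))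
        ((ContinuousAt.comp (g := Real.Gamma) (hGc ?_) (by fun_prop)).mul continuousAt_const) ?_
      · linarith
      · linarith [hb.2]
      · exact mul_ne_zero (Real.Gamma_pos_of_pos (by linarith [hb.2])).ne'
          (Real.Gamma_pos_of_pos hb.1).ne'
    refine (c1.tendsto.mono_left nhdsWithin_le_nhds).add
      ((c2.tendsto.mono_left nhdsWithin_le_nhds).mul ?_)
    exact (hasDerivAt_iff_tendsto_slope.1 (hasDerivAt_pi_div_sin hb)).mono_left
      (nhdsWithin_mono _ fun x hx => ne_of_lt hx)
  refine (hlim.congr' ?_).trans_eq ?_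
  · filter_upwards [hev] with a ha
    rw [(integral_oddPow_mul_rpow ha.1 ha.2 hb.2).2, beta_combination_eq ha.1 ha.2 hb.2]
  -- The limit is `π / sin (πb) - π cos (πb) / sin (πb)`, which the half-angle formulas turn into `π
  -- tan (πb/2)`.
  · congr 1
    have hs : 0 < Real.sin (Real.pi * b / 2) :=
      Real.sin_pos_of_pos_of_lt_pi (by have := hb.1; positivity)
        (by nlinarith [Real.pi_pos, hb.2])
    have hc : 0 < Real.cos (Real.pi * b / 2) :=
      Real.cos_pos_of_mem_Ioo ⟨by nlinarith [Real.pi_pos, hb.1], by nlinarith [Real.pi_pos, hb.2]⟩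
    have hpi := Real.pi_pos
    have hsc := Real.sin_sq_add_cos_sq (Real.pi * b / 2)
    have e := Real.Gamma_mul_Gamma_one_sub b
    rw [mul_comm (Real.Gamma (1 - b)), e]
    unfold beta
    rw [e, sub_self, add_zero, Real.Gamma_one, show b + (1 - b) = 1 by ring, Real.Gamma_one,
      show Real.pi * b = 2 * (Real.pi * b / 2) by ring, Real.sin_two_mul, Real.cos_two_mul,
      Real.tan_eq_sin_div_cos, show 2 * (Real.pi * b / 2) / 2 = Real.pi * b / 2 by ring]
    field_simp
    nlinarith

/-- Reflection at `α/2` gives the sine and reflection at `(1-α)/2` the cosine; their quotient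
cancels the tangent. -/
theorem fracConst_mul_fracConst_neg {α : ℝ} (hα : α ∈ Ioo (0 : ℝ) 1) :
    fracConst 1 α * fracConst 1 (-α) * (2 * (Real.pi * Real.tan (Real.pi * α / 2)) / α) = 1 := by
  have hs : 0 < Real.sin (Real.pi * α / 2) :=
    Real.sin_pos_of_pos_of_lt_pi (by have := hα.1; positivity)
      (by nlinarith [Real.pi_pos, hα.2])
  have hc : 0 < Real.cos (Real.pi * α / 2) :=
    Real.cos_pos_of_mem_Ioo ⟨by nlinarith [Real.pi_pos, hα.1], by nlinarith [Real.pi_pos, hα.2]⟩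
  have hpi := Real.pi_pos
  have hα0 := hα.1
  have r1 := Real.Gamma_mul_Gamma_one_sub (α / 2)
  have r2 := Real.Gamma_mul_Gamma_one_sub ((1 - α) / 2)
  rw [show Real.pi * (α / 2) = Real.pi * α / 2 by ring] at r1
  rw [show Real.pi * ((1 - α) / 2) = Real.pi / 2 - Real.pi * α / 2 by ring, Real.sin_pi_div_two_sub,
    show 1 - (1 - α) / 2 = (1 + α) / 2 by ring] at r2
  have g1 : Real.Gamma ((1 + α + 1) / 2) = α / 2 * Real.Gamma (α / 2) := by
    rw [show (1 + α + 1) / 2 = α / 2 + 1 by ring, Real.Gamma_add_one (by positivity)]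
  have p1 := Real.Gamma_pos_of_pos (by linarith [hα.2] : 0 < (1 - α) / 2)
  have p2 := Real.Gamma_pos_of_pos (by linarith : 0 < (1 + α) / 2)
  unfold fracConst
  simp only [Nat.cast_one]
  rw [g1, show (1 + -α + 1) / 2 = 1 - α / 2 by ring, show (1 - -α) / 2 = (1 + α) / 2 by ring,
    Real.tan_eq_sin_div_cos]
  have t1 : (2 : ℝ) ^ α * 2 ^ (-α) = 1 := by rw [← Real.rpow_add two_pos]; simp
  have t2 : Real.pi ^ (-(1 : ℝ) / 2) * Real.pi ^ (-(1 : ℝ) / 2) = Real.pi⁻¹ := by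
    rw [← Real.rpow_add hpi, show -(1 : ℝ) / 2 + -1 / 2 = -1 by norm_num, Real.rpow_neg_one]
  calc _ = ((2 : ℝ) ^ α * 2 ^ (-α)) * (Real.pi ^ (-(1 : ℝ) / 2) * Real.pi ^ (-(1 : ℝ) / 2)) *
        (α / 2 * (Real.Gamma (α / 2) * Real.Gamma (1 - α / 2))) /
        (Real.Gamma ((1 - α) / 2) * Real.Gamma ((1 + α) / 2)) *
        (2 * (Real.pi * (Real.sin (Real.pi * α / 2) / Real.cos (Real.pi * α / 2))) / α) := by
          field_simp
    _ = 1 := by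
      rw [t1, t2, r1, r2]
      field_simp

/-! ### The fractional divergence: representation by the derivative, and decay -/

theorem locallyIntegrable_abs_rpow {s : ℝ} (hs : -1 < s) :
    LocallyIntegrable (fun x : ℝ => |x| ^ s) := by
  refine locallyIntegrable_of_norm_le_rpow (C := 1) (α := -s) (by simp) (by simp; linarith)
    (ae_of_all _ fun x => ?_) (by fun_prop : Measurable fun x : ℝ => |x| ^ s).aestronglyMeasurable
  rw [Real.norm_of_nonneg (by positivity), neg_neg, one_mul, Real.norm_eq_abs]

theorem integrable_abs_rpow_mul {s : ℝ} (hs : -1 < s) {ψ : ℝ → ℝ} (hψ : Continuous ψ)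
    (hc : HasCompactSupport ψ) : Integrable (fun x => |x| ^ s * ψ x) :=
  (locallyIntegrable_abs_rpow hs).integrable_smul_right_of_hasCompactSupport hψ hc

theorem integrable_indicator_abs_rpow {s : ℝ} (hs : -1 < s) (R : ℝ) :
    Integrable (indicator (Icc (-R) R) fun x : ℝ => |x| ^ s) :=
  ((locallyIntegrable_abs_rpow hs).integrableOn_isCompact isCompact_Icc).integrable_indicator
    measurableSet_Icc

theorem integrableOn_abs_rpow_of_lt {s r : ℝ} (hs : s < -1) (hr : 0 < r) :
    IntegrableOn (fun x : ℝ => |x| ^ s) {x | r < |x|} := by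
  have h1 : IntegrableOn (fun x : ℝ => |x| ^ s) (Ioi r) :=
    (integrableOn_Ioi_rpow_of_lt hs hr).congr_fun
      (fun x hx => by rw [abs_of_pos (hr.trans hx)]) measurableSet_Ioi
  have h2 : IntegrableOn (fun x : ℝ => |x| ^ s) (Iio (-r)) := by
    rw [← (Measure.measurePreserving_neg (volume : Measure ℝ)).integrableOn_comp_preimage
      (MeasurableEquiv.neg ℝ).measurableEmbedding]
    have : (fun x : ℝ => -x) ⁻¹' Iio (-r) = Ioi r := by ext; simp
    rw [this]
    exact h1.congr_fun (fun x _ => by simp) measurableSet_Ioi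
  refine (h1.union h2).mono_set fun x hx => ?_
  rcases lt_abs.1 (show r < |x| from hx) with h | h
  · exact Or.inl h
  · exact Or.inr (by simp only [mem_Iio]; linarith)

/-- The integral in the fractional divergence, before normalisation. -/
noncomputable def divKernel (α : ℝ) (φ : ℝ → ℝ) (x : ℝ) : ℝ :=
  ∫ y, (y - x) * (φ y - φ x) / |y - x| ^ (α + 2)

theorem fracDiv_eq (α : ℝ) (φ : ℝ → ℝ) (x : ℝ) :
    fracDiv α φ x = fracConst 1 α * divKernel α φ x := rfl

theorem mul_div_abs_rpow_eq {α : ℝ} (h c : ℝ) (hh : h ≠ 0) :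
    h * (h * c) / |h| ^ (α + 2) = |h| ^ (-α) * c := by
  have : 0 < |h| := abs_pos.2 hh
  rw [Real.rpow_add this, Real.rpow_neg this.le, Real.rpow_two, sq_abs]
  have := (Real.rpow_pos_of_pos this α).ne'
  field_simp

theorem integral_abs_rpow_mul_comp_mul {α t : ℝ} (ht : 0 < t) (ψ : ℝ → ℝ) :
    ∫ h, |h| ^ (-α) * ψ (t * h) = t ^ (α - 1) * ∫ h, |h| ^ (-α) * ψ h := by
  have e : (fun h : ℝ => |h| ^ (-α) * ψ (t * h)) =
      fun h => t ^ α * (fun k : ℝ => |k| ^ (-α) * ψ k) (t * h) := by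
    ext h
    simp only
    rw [abs_mul, abs_of_pos ht, Real.mul_rpow ht.le (abs_nonneg h)]
    have : t ^ α * t ^ (-α) = 1 := by rw [← Real.rpow_add ht]; simp
    linear_combination (-(|h| ^ (-α) * ψ (t * h))) * this
  rw [e, integral_const_mul,
    Measure.integral_comp_mul_left (fun k : ℝ => |k| ^ (-α) * ψ k), abs_of_pos (inv_pos.2 ht),
    smul_eq_mul, ← mul_assoc, Real.rpow_sub_one ht.ne', div_eq_mul_inv]

/-- Write `φ (x + h) - φ x` as `h ∫₀¹ φ'(x + th) dt` and swap the integrals. Rescaling `h` produces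
the factor `t^(α-1)`, whose integral over the unit interval is `1/α`. -/
theorem divKernel_eq {α : ℝ} (hα : α ∈ Ioo (0 : ℝ) 1) {φ : ℝ → ℝ} (hφ : IsTestFunction φ) (x : ℝ) :
    divKernel α φ x = 1 / α * ∫ h, |h| ^ (-α) * deriv φ (x + h) := by
  have hφ' : Continuous (deriv φ) := hφ.contDiff.continuous_deriv (by simp)
  have hd : Differentiable ℝ φ := hφ.contDiff.differentiable (by simp)
  have hα' : -1 < -α := by linarith [hα.2]
  have hcs : HasCompactSupport fun h => deriv φ (x + h) :=
    hφ.hasCompactSupport.deriv.comp_homeomorph (Homeomorph.addLeft x)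
  have hpow : IntegrableOn (fun t : ℝ => t ^ (α - 1)) (Ioo 0 1) :=
    (intervalIntegral.integrableOn_Ioo_rpow_iff one_pos).2 (by linarith [hα.1])
  have hprod : Integrable (Function.uncurry fun t h : ℝ => |h| ^ (-α) * deriv φ (x + t * h))
      ((volume.restrict (Ioo 0 1)).prod volume) := by
    rw [integrable_prod_iff]
    · constructor
      · refine ae_restrict_of_forall_mem measurableSet_Ioo fun t ht => ?_
        refine integrable_abs_rpow_mul hα' (by fun_prop) ?_
        exact hcs.comp_homeomorph (Homeomorph.mulLeft₀ t ht.1.ne')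
      · refine (hpow.mul_const (∫ h, |h| ^ (-α) * ‖deriv φ (x + h)‖)).congr
          (ae_restrict_of_forall_mem measurableSet_Ioo fun t ht => ?_)
        refine (integral_abs_rpow_mul_comp_mul ht.1 fun h => ‖deriv φ (x + h)‖).symm.trans ?_
        refine integral_congr_ae (ae_of_all _ fun h => ?_)
        simp only [Function.uncurry]
        rw [norm_mul, Real.norm_of_nonneg (by positivity : 0 ≤ |h| ^ (-α))]
    · have : Measurable (Function.uncurry fun t h : ℝ => |h| ^ (-α) * deriv φ (x + t * h)) := by
        unfold Function.uncurry
        have := hφ'.measurable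
        fun_prop
      exact this.aestronglyMeasurable
  have hswap := integral_integral_swap hprod
  calc divKernel α φ x
      = ∫ h, (h + x - x) * (φ (h + x) - φ x) / |h + x - x| ^ (α + 2) :=
        (integral_add_right_eq_self
          (fun y => (y - x) * (φ y - φ x) / |y - x| ^ (α + 2)) x).symm
    _ = ∫ h, ∫ t in Ioo (0 : ℝ) 1, |h| ^ (-α) * deriv φ (x + t * h) := by
        refine integral_congr_ae ?_
        filter_upwards [compl_mem_ae_iff.2 (measure_singleton (0 : ℝ))] with h hh
        have key : φ (h + x) - φ x = h * ∫ t in Ioo (0 : ℝ) 1, deriv φ (x + t * h) := by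
          rw [← integral_Ioc_eq_integral_Ioo, ← intervalIntegral.integral_of_le zero_le_one,
            ← intervalIntegral.integral_const_mul]
          have hder : ∀ t ∈ uIcc (0 : ℝ) 1,
              HasDerivAt (fun t => φ (x + t * h)) (h * deriv φ (x + t * h)) t := by
            intro t _
            have h1 : HasDerivAt (fun t : ℝ => x + t * h) h t := by
              simpa using ((hasDerivAt_id' t).mul_const h).const_add x
            have := (hd (x + t * h)).hasDerivAt.comp t h1
            rw [mul_comm]
            exact this
          rw [intervalIntegral.integral_eq_sub_of_hasDerivAt hder
            (Continuous.intervalIntegrable (by fun_prop) _ _)]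
          simp [add_comm]
        rw [integral_const_mul, ← mul_div_abs_rpow_eq h _ hh, key]
        simp
    _ = ∫ t in Ioo (0 : ℝ) 1, t ^ (α - 1) * ∫ h, |h| ^ (-α) * deriv φ (x + h) := by
        rw [← hswap]
        refine setIntegral_congr_fun measurableSet_Ioo fun t ht => ?_
        exact integral_abs_rpow_mul_comp_mul ht.1 fun h => deriv φ (x + h)
    _ = _ := by
        rw [integral_mul_const, ← integral_Ioc_eq_integral_Ioo,
          ← intervalIntegral.integral_of_le zero_le_one,
          integral_rpow (Or.inl (by linarith [hα.1]))]
        simp [hα.1.ne']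

theorem measurable_divKernel (α : ℝ) {φ : ℝ → ℝ} (hφ : Measurable φ) :
    Measurable (divKernel α φ) := by
  have : Measurable fun q : ℝ × ℝ =>
      (q.2 - q.1) * (φ q.2 - φ q.1) / |q.2 - q.1| ^ (α + 2) := by fun_prop
  exact this.stronglyMeasurable.integral_prod_right'.measurable

/-- For `|h| ≤ 1` the sup norm of `φ'` is used against the integrable singularity; for `|h| > 1` the
kernel is at most one and the `L¹` norm of `φ'` suffices. -/
theorem exists_abs_divKernel_le {α : ℝ} (hα : α ∈ Ioo (0 : ℝ) 1) {φ : ℝ → ℝ}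
    (hφ : IsTestFunction φ) : ∃ C, ∀ x, |divKernel α φ x| ≤ C := by
  have hφ' : Continuous (deriv φ) := hφ.contDiff.continuous_deriv (by simp)
  have hα' : -1 < -α := by linarith [hα.2]
  obtain ⟨M, hM⟩ := hφ.hasCompactSupport.deriv.exists_bound_of_continuous hφ'
  have hi : Integrable (deriv φ) := hφ'.integrable_of_hasCompactSupport hφ.hasCompactSupport.deriv
  have hk := integrable_indicator_abs_rpow hα' 1
  refine ⟨1 / α * ((∫ h, M * indicator (Icc (-1) 1) (fun h : ℝ => |h| ^ (-α)) h) +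
    ∫ h, ‖deriv φ h‖), fun x => ?_⟩
  have hcs : HasCompactSupport fun h => deriv φ (x + h) :=
    hφ.hasCompactSupport.deriv.comp_homeomorph (Homeomorph.addLeft x)
  have hI : Integrable fun h => |h| ^ (-α) * deriv φ (x + h) :=
    integrable_abs_rpow_mul hα' (by fun_prop) hcs
  rw [divKernel_eq hα hφ, abs_mul, abs_of_pos (one_div_pos.2 hα.1)]
  refine mul_le_mul_of_nonneg_left ?_ (one_div_pos.2 hα.1).le
  rw [← integral_add_left_eq_self (fun h => ‖deriv φ h‖) x,
    ← integral_add (hk.const_mul M) (hi.comp_add_left x).norm]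
  refine (norm_integral_le_integral_norm _).trans
    (integral_mono hI.norm ((hk.const_mul M).add (hi.comp_add_left x).norm) fun h => ?_)
  have hM0 : 0 ≤ M := (norm_nonneg _).trans (hM 0)
  simp only [norm_mul, Real.norm_of_nonneg (by positivity : (0 : ℝ) ≤ |h| ^ (-α)), Pi.add_apply]
  by_cases hh : h ∈ Icc (-1 : ℝ) 1
  · rw [indicator_of_mem hh, mul_comm]
    exact le_add_of_le_of_nonneg (mul_le_mul_of_nonneg_right (hM _) (by positivity)) (norm_nonneg _)
  · rw [indicator_of_notMem hh, mul_zero, zero_add]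
    refine mul_le_of_le_one_left (norm_nonneg _) (Real.rpow_le_one_of_one_le_of_nonpos ?_
      (by linarith [hα.1]))
    by_contra hlt
    exact hh ⟨(abs_lt.1 (not_le.1 hlt)).1.le, (abs_lt.1 (not_le.1 hlt)).2.le⟩

/-- Away from the support `φ x` vanishes, and only the kernel, of size `|y - x|^(-(1+α))`, and the
mass of `|φ|` matter. This decay is what makes the product with `oddPow α` integrable at infinity.
-/
theorem exists_abs_divKernel_le_rpow {α : ℝ} (hα : α ∈ Ioo (0 : ℝ) 1) {φ : ℝ → ℝ}
    (hφ : IsTestFunction φ) :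
    ∃ C, 0 ≤ C ∧ ∀ x, |divKernel α φ x| ≤ C * (1 + |x|) ^ (-(1 + α)) := by
  obtain ⟨C₀, hC₀⟩ := exists_abs_divKernel_le hα hφ
  obtain ⟨R, hR1, hR⟩ : ∃ R, 1 ≤ R ∧ ∀ y, R < |y| → φ y = 0 := by
    obtain ⟨R, hR⟩ := hφ.hasCompactSupport.isCompact.isBounded.subset_closedBall 0
    refine ⟨max R 1, le_max_right _ _, fun y hy => ?_⟩
    refine image_eq_zero_of_notMem_tsupport fun hmem => ?_
    have := hR hmem
    rw [mem_closedBall_zero_iff, Real.norm_eq_abs] at this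
    exact absurd ((le_max_left R 1).trans_lt hy) this.not_gt
  have hC0' : 0 ≤ C₀ := (abs_nonneg _).trans (hC₀ 0)
  have hφi : Integrable φ := hφ.contDiff.continuous.integrable_of_hasCompactSupport
    hφ.hasCompactSupport
  set N := ∫ y, |φ y|
  have hN : 0 ≤ N := integral_nonneg fun y => abs_nonneg _
  have hp : 0 < 1 + α := by linarith [hα.1]
  refine ⟨C₀ * (1 + 2 * R) ^ (1 + α) + 4 ^ (1 + α) * N, by positivity, fun x => ?_⟩
  have hx0 : 0 < 1 + |x| := by positivity
  rcases lt_or_ge |x| (2 * R) with hx | hx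
  · have h1 : 1 ≤ (1 + 2 * R) ^ (1 + α) * (1 + |x|) ^ (-(1 + α)) := by
      rw [Real.rpow_neg hx0.le, ← div_eq_mul_inv, one_le_div (by positivity)]
      exact Real.rpow_le_rpow hx0.le (by linarith) hp.le
    calc |divKernel α φ x| ≤ C₀ * 1 := by simpa using hC₀ x
      _ ≤ C₀ * ((1 + 2 * R) ^ (1 + α) * (1 + |x|) ^ (-(1 + α))) := by gcongr
      _ ≤ _ := by
        rw [add_mul, ← mul_assoc]
        exact le_add_of_nonneg_right (by positivity)
  · have hb : ∀ y, |(y - x) * (φ y - φ x) / |y - x| ^ (α + 2)| ≤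
        4 ^ (1 + α) * (1 + |x|) ^ (-(1 + α)) * |φ y| := by
      intro y
      rw [hR x (by linarith), sub_zero]
      rcases lt_or_ge R |y| with hy | hy
      · simp [hR y hy]
      -- Here `|y| ≤ R ≤ |x|/2`, so the distance is at least `|x|/2`; the normalisation `1 ≤ R` lets
      -- this absorb the `1`.
      · have h2 : (1 + |x|) / 4 ≤ |y - x| := by
          have := abs_sub_abs_le_abs_sub x y
          rw [abs_sub_comm] at this
          linarith
        have h3 : 0 < |y - x| := lt_of_lt_of_le (by positivity) h2
        rw [abs_div, abs_mul, abs_of_nonneg (by positivity : (0 : ℝ) ≤ |y - x| ^ (α + 2)),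
          show α + 2 = (1 + α) + 1 by ring, Real.rpow_add_one h3.ne']
        have h4 : ((1 + |x|) / 4) ^ (1 + α) ≤ |y - x| ^ (1 + α) := by gcongr
        have h5 : 4 ^ (1 + α) * (1 + |x|) ^ (-(1 + α)) = (((1 + |x|) / 4) ^ (1 + α))⁻¹ := by
          rw [Real.div_rpow hx0.le (by norm_num), Real.rpow_neg hx0.le, inv_div, div_eq_mul_inv]
        rw [h5, mul_comm (|y - x| ^ (1 + α)), mul_div_mul_left _ _ h3.ne', div_eq_inv_mul]
        gcongr
    calc |divKernel α φ x| ≤ ∫ y, 4 ^ (1 + α) * (1 + |x|) ^ (-(1 + α)) * |φ y| :=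
          norm_integral_le_of_norm_le
            (f := fun y => (y - x) * (φ y - φ x) / |y - x| ^ (α + 2))
            (hφi.abs.const_mul _) (ae_of_all _ hb)
      _ = 4 ^ (1 + α) * N * (1 + |x|) ^ (-(1 + α)) := by rw [integral_const_mul]; ring
      _ ≤ _ := by
        rw [add_mul]
        exact le_add_of_nonneg_left (by positivity)

/-! ### Inversion: pairing the odd kernel with the divergence -/

theorem abs_sign_le_one (x : ℝ) : |Real.sign x| ≤ 1 := by
  rcases Real.sign_apply_eq x with h | h | h <;> simp [h]

theorem sign_mul_sign (x y : ℝ) : Real.sign (x * y) = Real.sign x * Real.sign y := by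
  rcases lt_trichotomy x 0 with hx | rfl | hx <;> rcases lt_trichotomy y 0 with hy | rfl | hy
  · rw [Real.sign_of_neg hx, Real.sign_of_neg hy, Real.sign_of_pos (mul_pos_of_neg_of_neg hx hy)]
    norm_num
  · simp
  · rw [Real.sign_of_neg hx, Real.sign_of_pos hy, Real.sign_of_neg (mul_neg_of_neg_of_pos hx hy)]
    norm_num
  · simp
  · simp
  · simp
  · rw [Real.sign_of_pos hx, Real.sign_of_neg hy, Real.sign_of_neg (mul_neg_of_pos_of_neg hx hy)]
    norm_num
  · simp
  · rw [Real.sign_of_pos hx, Real.sign_of_pos hy, Real.sign_of_pos (mul_pos hx hy)]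
    norm_num

theorem rpow_le_rpow_add_rpow {t r s u : ℝ} (ht : 0 < t) (hrs : r ≤ s) (hsu : s ≤ u) :
    t ^ s ≤ t ^ r + t ^ u := by
  rcases le_total t 1 with h | h
  · exact le_add_of_le_of_nonneg (Real.rpow_le_rpow_of_exponent_ge ht h hrs) (by positivity)
  · exact le_add_of_nonneg_of_le (by positivity) (Real.rpow_le_rpow_of_exponent_le h hsu)

theorem oddPow_mul_rpow_scaling {a b y : ℝ} (hy : y ≠ 0) (t : ℝ) :
    oddPow a (y * t) * |y - y * t| ^ (-b) =
      Real.sign y * |y| ^ (a - 1 - b) * (oddPow a t * |1 - t| ^ (-b)) := by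
  have h : 0 < |y| := abs_pos.2 hy
  unfold oddPow
  rw [sign_mul_sign, abs_mul, Real.mul_rpow h.le (abs_nonneg t),
    show y - y * t = y * (1 - t) by ring, abs_mul, Real.mul_rpow h.le (abs_nonneg _),
    sub_eq_add_neg (a - 1), Real.rpow_add h]
  ring

theorem integrable_oddPow_mul_rpow {a b y : ℝ} (ha : 0 < a) (hab : a < b) (hb : b < 1)
    (hy : y ≠ 0) : Integrable (fun x => oddPow a x * |y - x| ^ (-b)) := by
  rw [← integrable_comp_mul_left_iff _ hy]
  simp only [oddPow_mul_rpow_scaling hy]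
  exact (integral_oddPow_mul_rpow ha hab hb).1.const_mul _

theorem integral_oddPow_mul_rpow_eq {a b y : ℝ} (hy : y ≠ 0) :
    ∫ x, oddPow a x * |y - x| ^ (-b) =
      Real.sign y * |y| ^ (a - b) * ∫ t, oddPow a t * |1 - t| ^ (-b) := by
  have h : 0 < |y| := abs_pos.2 hy
  have := Measure.integral_comp_mul_left (fun x => oddPow a x * |y - x| ^ (-b)) y
  simp only [oddPow_mul_rpow_scaling hy] at this
  rw [integral_const_mul, abs_inv, smul_eq_mul, eq_inv_mul_iff_mul_eq₀ h.ne'] at this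
  rw [← this, show a - b = (a - 1 - b) + 1 by ring, Real.rpow_add_one h.ne']
  ring

theorem integral_norm_oddPow_mul_rpow_eq {a b y : ℝ} (hy : y ≠ 0) :
    ∫ x, ‖oddPow a x * |y - x| ^ (-b)‖ =
      |y| ^ (a - b) * ∫ t, ‖oddPow a t * |1 - t| ^ (-b)‖ := by
  have h : 0 < |y| := abs_pos.2 hy
  have hs : ‖Real.sign y‖ = 1 := by
    rcases lt_or_gt_of_ne hy with h | h
    · simp [Real.sign_of_neg h]
    · simp [Real.sign_of_pos h]
  have := Measure.integral_comp_mul_left (fun x => ‖oddPow a x * |y - x| ^ (-b)‖) y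
  have e : ∀ t, ‖oddPow a (y * t) * |y - y * t| ^ (-b)‖ =
      |y| ^ (a - 1 - b) * ‖oddPow a t * |1 - t| ^ (-b)‖ := fun t => by
    rw [oddPow_mul_rpow_scaling hy, norm_mul, norm_mul (Real.sign y), hs, one_mul,
      Real.norm_of_nonneg (by positivity : (0 : ℝ) ≤ |y| ^ (a - 1 - b))]
  simp only [e] at this
  rw [integral_const_mul, abs_inv, smul_eq_mul, eq_inv_mul_iff_mul_eq₀ h.ne'] at this
  rw [← this, show a - b = (a - 1 - b) + 1 by ring, Real.rpow_add_one h.ne']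
  ring

/-- Fubini after inserting `divKernel_eq`; the inner integral in `x` is homogeneous in `y`. The
strict inequality `a < α` is needed for its absolute convergence. -/
theorem integral_oddPow_mul_divKernel_of_lt {a α : ℝ} (ha : 0 < a) (haα : a < α) (hα : α < 1)
    {φ : ℝ → ℝ} (hφ : IsTestFunction φ) :
    ∫ x, oddPow a x * divKernel α φ x =
      1 / α * ((∫ t, oddPow a t * |1 - t| ^ (-α)) *
        ∫ y, Real.sign y * |y| ^ (a - α) * deriv φ y) := by
  have hφ' : Continuous (deriv φ) := hφ.contDiff.continuous_deriv (by simp)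
  have hcs := hφ.hasCompactSupport.deriv
  have hne : ∀ᵐ y : ℝ, y ≠ 0 := compl_mem_ae_iff.2 (measure_singleton (0 : ℝ))
  have hprod : Integrable (Function.uncurry fun x y : ℝ =>
      oddPow a x * |y - x| ^ (-α) * deriv φ y) (volume.prod volume) := by
    rw [integrable_prod_iff']
    · constructor
      · filter_upwards [hne] with y hy
        exact (integrable_oddPow_mul_rpow ha haα hα hy).mul_const (deriv φ y)
      · refine ((integrable_abs_rpow_mul (s := a - α) (by linarith) hφ'.norm hcs.norm).mul_const
          (∫ t, ‖oddPow a t * |1 - t| ^ (-α)‖)).congr ?_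
        filter_upwards [hne] with y hy
        simp only [Function.uncurry, norm_mul _ (deriv φ y)]
        rw [integral_mul_const, integral_norm_oddPow_mul_rpow_eq hy]
        ring
    · have : Measurable (Function.uncurry fun x y : ℝ =>
          oddPow a x * |y - x| ^ (-α) * deriv φ y) := by
        unfold Function.uncurry
        have := hφ'.measurable
        fun_prop
      exact this.aestronglyMeasurable
  calc ∫ x, oddPow a x * divKernel α φ x
      = ∫ x, 1 / α * ∫ y, oddPow a x * |y - x| ^ (-α) * deriv φ y := by
        congr 1 with x
        rw [divKernel_eq ⟨ha.trans haα, hα⟩ hφ]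
        simp only [mul_assoc]
        rw [integral_const_mul, ← integral_add_right_eq_self
          (fun y => |y - x| ^ (-α) * deriv φ y) x]
        simp only [add_sub_cancel_right, add_comm x]
        ring
    _ = 1 / α * ∫ y, ∫ x, oddPow a x * |y - x| ^ (-α) * deriv φ y := by
        rw [integral_const_mul, integral_integral_swap hprod]
    _ = _ := by
        congr 1
        rw [← integral_const_mul]
        refine integral_congr_ae ?_
        filter_upwards [hne] with y hy
        rw [integral_mul_const, integral_oddPow_mul_rpow_eq hy]
        ring

theorem integral_sign_mul_deriv {φ : ℝ → ℝ} (hφ : IsTestFunction φ) :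
    ∫ y, Real.sign y * deriv φ y = -2 * φ 0 := by
  have hφ' : Continuous (deriv φ) := hφ.contDiff.continuous_deriv (by simp)
  have h1 : ContDiff ℝ 1 φ := hφ.contDiff.of_le (by simp)
  have hi : Integrable (deriv φ) := hφ'.integrable_of_hasCompactSupport hφ.hasCompactSupport.deriv
  have hI : Integrable fun y => Real.sign y * deriv φ y :=
    hi.bdd_mul measurable_sign.aestronglyMeasurable (ae_of_all _ abs_sign_le_one)
  rw [← setIntegral_univ, ← Iic_union_Ioi (a := (0 : ℝ)),
    setIntegral_union (Iic_disjoint_Ioi le_rfl) measurableSet_Ioi hI.integrableOn hI.integrableOn,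
    setIntegral_congr_fun (g := deriv φ) measurableSet_Ioi
      (fun y hy => by simp only [Real.sign_of_pos hy, one_mul]),
    hφ.hasCompactSupport.integral_Ioi_deriv_eq h1, integral_Iic_eq_integral_Iio,
    setIntegral_congr_fun (g := fun y => -deriv φ y) measurableSet_Iio
      (fun y hy => by simp only [Real.sign_of_neg hy]; ring),
    integral_neg, ← integral_Iic_eq_integral_Iio, hφ.hasCompactSupport.integral_Iic_deriv_eq h1]
  ring

theorem integrable_abs_rpow_mul_one_add_abs_rpow {s q : ℝ} (hs : -1 < s)
    (hsq : s - q < -1) : Integrable fun x : ℝ => |x| ^ s * (1 + |x|) ^ (-q) := by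
  have h2 : Integrable (indicator {x : ℝ | 1 < |x|} fun x => |x| ^ (s - q)) :=
    (integrableOn_abs_rpow_of_lt hsq one_pos).integrable_indicator
      (measurableSet_lt measurable_const measurable_norm)
  refine ((integrable_indicator_abs_rpow hs 1).add h2).mono'
    (by fun_prop : Measurable fun x : ℝ => |x| ^ s * (1 + |x|) ^ (-q)).aestronglyMeasurable
    (ae_of_all _ fun x => ?_)
  rw [Real.norm_of_nonneg (by positivity), Pi.add_apply]
  have hx0 : 0 < 1 + |x| := by positivity
  rcases le_or_gt |x| 1 with hx | hx
  · rw [indicator_of_mem (show x ∈ Icc (-1) 1 from abs_le.1 hx),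
      indicator_of_notMem (by simpa using hx),
      add_zero]
    exact mul_le_of_le_one_right (by positivity)
      (Real.rpow_le_one_of_one_le_of_nonpos (by linarith [abs_nonneg x]) (by linarith))
  · rw [indicator_of_notMem (fun h : x ∈ Icc (-1) 1 => (abs_le.2 h).not_gt hx),
      indicator_of_mem (show x ∈ {x : ℝ | 1 < |x|} from hx), zero_add]
    have hx' : 0 < |x| := one_pos.trans hx
    rw [sub_eq_add_neg, Real.rpow_add hx']
    exact mul_le_mul_of_nonneg_left
      (Real.rpow_le_rpow_of_nonpos hx' (by linarith) (by linarith)) (by positivity)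

theorem integrable_oddPow_mul_divKernel {α : ℝ} (hα : α ∈ Ioo (0 : ℝ) 1)
    {φ : ℝ → ℝ} (hφ : IsTestFunction φ) :
    Integrable fun x => oddPow α x * divKernel α φ x := by
  obtain ⟨C, hC0, hC⟩ := exists_abs_divKernel_le_rpow hα hφ
  have hm := measurable_divKernel α hφ.contDiff.continuous.measurable
  refine ((integrable_abs_rpow_mul_one_add_abs_rpow (s := α - 1) (q := 1 + α)
    (by linarith [hα.1]) (by linarith)).const_mul C).mono'
    ((measurable_oddPow α).mul hm).aestronglyMeasurable (ae_of_all _ fun x => ?_)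
  rw [norm_mul, mul_left_comm]
  exact mul_le_mul (abs_oddPow_le _ _) (hC x) (norm_nonneg _) (by positivity)

theorem tendsto_oddPow (α x : ℝ) : Tendsto (fun a => oddPow a x) (𝓝 α) (𝓝 (oddPow α x)) := by
  unfold oddPow
  rcases eq_or_ne x 0 with rfl | hx
  · simp
  · refine Tendsto.mul_const _ ?_
    have : Continuous fun a : ℝ => |x| ^ (a - 1) :=
      
      continuous_const.rpow (by fun_prop) fun _ => Or.inl (abs_pos.2 hx).ne'
    exact this.tendsto α

/-- Both sides of `integral_oddPow_mul_divKernel_of_lt` pass to the limit `a ↑ α` by dominated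
convergence, and uniqueness of limits gives the identity at the critical exponent. -/
theorem integral_oddPow_mul_divKernel {α : ℝ} (hα : α ∈ Ioo (0 : ℝ) 1)
    {φ : ℝ → ℝ} (hφ : IsTestFunction φ) :
    ∫ x, oddPow α x * divKernel α φ x =
      -(2 * (Real.pi * Real.tan (Real.pi * α / 2)) / α) * φ 0 := by
  obtain ⟨C, hC0, hC⟩ := exists_abs_divKernel_le_rpow hα hφ
  have hm := measurable_divKernel α hφ.contDiff.continuous.measurable
  have hφ' : Continuous (deriv φ) := hφ.contDiff.continuous_deriv (by simp)
  have hcs := hφ.hasCompactSupport.deriv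
  have hα0 := hα.1
  have hev : ∀ᶠ a in 𝓝[<] α, a ∈ Ioo (α / 2) α := Ioo_mem_nhdsLT (by linarith)
  have hL : Tendsto (fun a => ∫ x, oddPow a x * divKernel α φ x) (𝓝[<] α)
      (𝓝 (∫ x, oddPow α x * divKernel α φ x)) := by
    refine tendsto_integral_filter_of_dominated_convergence
      -- For `a` between `α/2` and `α`, the power `|x|^(a-1)` is dominated by the sum of the two
      -- endpoint powers, both integrable against the decay of `divKernel`.
      (fun x => C * (|x| ^ (α / 2 - 1) * (1 + |x|) ^ (-(1 + α)) +
        |x| ^ (α - 1) * (1 + |x|) ^ (-(1 + α))))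
      (Eventually.of_forall fun a => ((measurable_oddPow a).mul hm).aestronglyMeasurable)
      ?_ ?_ (ae_of_all _ fun x =>
        ((tendsto_oddPow α x).mono_left nhdsWithin_le_nhds).mul_const _)
    · filter_upwards [hev] with a ha
      refine ae_of_all _ fun x => ?_
      rcases eq_or_ne x 0 with rfl | hx
      · simp only [oddPow, Real.sign_zero, mul_zero, zero_mul, norm_zero]
        positivity
      · rw [norm_mul, ← add_mul, mul_left_comm]
        refine mul_le_mul ((abs_oddPow_le _ _).trans ?_) (hC x) (norm_nonneg _) (by positivity)
        exact rpow_le_rpow_add_rpow (abs_pos.2 hx) (by linarith [ha.1]) (by linarith [ha.2])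
    · exact ((integrable_abs_rpow_mul_one_add_abs_rpow (by linarith) (by linarith)).add
        (integrable_abs_rpow_mul_one_add_abs_rpow (by linarith) (by linarith))).const_mul C
  have hR : Tendsto (fun a => ∫ y, Real.sign y * |y| ^ (a - α) * deriv φ y) (𝓝[<] α)
      (𝓝 (∫ y, Real.sign y * deriv φ y)) := by
    refine tendsto_integral_filter_of_dominated_convergence
      (fun y => |y| ^ (-(α / 2)) * ‖deriv φ y‖ + |y| ^ (0 : ℝ) * ‖deriv φ y‖)
      (Eventually.of_forall fun a => ?_) ?_ ?_ ?_
    · exact ((measurable_sign.mul (by fun_prop)).mul hφ'.measurable).aestronglyMeasurable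
    · filter_upwards [hev] with a ha
      refine ae_of_all _ fun y => ?_
      rcases eq_or_ne y 0 with rfl | hy
      · simp only [Real.sign_zero, zero_mul, norm_zero]
        positivity
      · rw [norm_mul, ← add_mul]
        refine mul_le_mul_of_nonneg_right ?_ (norm_nonneg _)
        rw [norm_mul, Real.norm_of_nonneg (by positivity : (0 : ℝ) ≤ |y| ^ (a - α))]
        refine (mul_le_of_le_one_left (by positivity) (abs_sign_le_one y)).trans ?_
        exact rpow_le_rpow_add_rpow (abs_pos.2 hy) (by linarith [ha.1]) (by linarith [ha.2])
    · exact (integrable_abs_rpow_mul (by linarith [hα.2]) hφ'.norm hcs.norm).add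
        (integrable_abs_rpow_mul (by linarith [hα.2]) hφ'.norm hcs.norm)
    · refine ae_of_all _ fun y => Tendsto.mul_const _ ?_
      rcases eq_or_ne y 0 with rfl | hy
      · simp
      · have : Continuous fun a : ℝ => Real.sign y * |y| ^ (a - α) :=
          continuous_const.mul (continuous_const.rpow (by fun_prop)
            fun _ => Or.inl (abs_pos.2 hy).ne')
        simpa using (this.tendsto α).mono_left nhdsWithin_le_nhds
  have hR' := ((tendsto_integral_oddPow hα).mul hR).const_mul (1 / α)
  have := tendsto_nhds_unique (hL.congr' ?_) hR'
  · rw [this, integral_sign_mul_deriv hφ]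
    ring
  · filter_upwards [hev] with a ha
    exact integral_oddPow_mul_divKernel_of_lt (by linarith [ha.1]) ha.2 hα.2 hφ

/-! ### The function `f_α`: its fractional derivative and its size -/

theorem fAlpha_eq (α x : ℝ) :
    fAlpha α x = fracConst 1 (-α) * (oddPow α x - oddPow α (x - 1)) := rfl

theorem IsTestFunction.comp_add_right {φ : ℝ → ℝ} (hφ : IsTestFunction φ) (c : ℝ) :
    IsTestFunction fun x => φ (x + c) where
  contDiff := hφ.contDiff.comp (by fun_prop)
  hasCompactSupport := hφ.hasCompactSupport.comp_homeomorph (Homeomorph.addRight c)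

theorem divKernel_add (α : ℝ) (φ : ℝ → ℝ) (x c : ℝ) :
    divKernel α φ (x + c) = divKernel α (fun x => φ (x + c)) x := by
  unfold divKernel
  rw [← integral_add_right_eq_self _ c]
  simp

theorem integral_oddPow_sub_mul_divKernel {α : ℝ} (hα : α ∈ Ioo (0 : ℝ) 1)
    {φ : ℝ → ℝ} (hφ : IsTestFunction φ) (c : ℝ) :
    Integrable (fun x => oddPow α (x - c) * divKernel α φ x) ∧
    ∫ x, oddPow α (x - c) * divKernel α φ x =
      -(2 * (Real.pi * Real.tan (Real.pi * α / 2)) / α) * φ c := by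
  have e : (fun x => oddPow α x * divKernel α (fun x => φ (x + c)) x) =
      fun x => (fun x => oddPow α (x - c) * divKernel α φ x) (x + c) := by
    ext x; simp [divKernel_add]
  constructor
  · have := integrable_oddPow_mul_divKernel hα (hφ.comp_add_right c)
    rw [e] at this
    simpa using this.comp_add_right (-c)
  · rw [← integral_add_right_eq_self _ c, ← e, integral_oddPow_mul_divKernel hα
      (hφ.comp_add_right c), zero_add]

theorem integral_fAlpha_sub_mul_fracDiv {α : ℝ} (hα : α ∈ Ioo (0 : ℝ) 1)
    {φ : ℝ → ℝ} (hφ : IsTestFunction φ) (z : ℝ) :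
    ∫ x, fAlpha α (x - z) * fracDiv α φ x = φ (z + 1) - φ z := by
  obtain ⟨i1, v1⟩ := integral_oddPow_sub_mul_divKernel hα hφ z
  obtain ⟨i2, v2⟩ := integral_oddPow_sub_mul_divKernel hα hφ (z + 1)
  have e : (fun x => fAlpha α (x - z) * fracDiv α φ x) = fun x =>
      fracConst 1 α * fracConst 1 (-α) * (oddPow α (x - z) * divKernel α φ x -
        oddPow α (x - (z + 1)) * divKernel α φ x) := by
    ext x
    rw [fAlpha_eq, fracDiv_eq, sub_sub]
    ring
  rw [e, integral_const_mul, integral_sub i1 i2, v1, v2]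
  linear_combination (φ (z + 1) - φ z) * fracConst_mul_fracConst_neg hα

theorem abs_fAlpha_le (α z : ℝ) :
    |fAlpha α z| ≤ |fracConst 1 (-α)| * (|z| ^ (α - 1) + |z - 1| ^ (α - 1)) := by
  rw [fAlpha_eq, abs_mul]
  gcongr
  exact (abs_sub _ _).trans (add_le_add (abs_oddPow_le _ _) (abs_oddPow_le _ _))

@[fun_prop]
theorem measurable_fAlpha (α : ℝ) : Measurable (fAlpha α) := by
  have : fAlpha α = fun x => fracConst 1 (-α) * (oddPow α x - oddPow α (x - 1)) := rfl
  rw [this]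
  fun_prop

/-- Since `t^α ≤ (t+1)^α`, the left side is at most `t^α (1/t - 1/(t+1))`, and the bracket is at
most `1/t²`. -/
theorem rpow_sub_rpow_add_one_le {α t : ℝ} (hα : 0 ≤ α) (ht : 0 < t) :
    t ^ (α - 1) - (t + 1) ^ (α - 1) ≤ t ^ (α - 2) := by
  have h1 : 0 < t + 1 := by positivity
  have h2 : t ^ α ≤ (t + 1) ^ α := Real.rpow_le_rpow ht.le (by linarith) hα
  have h3 : 0 < t ^ α := Real.rpow_pos_of_pos ht α
  rw [Real.rpow_sub_one ht.ne', Real.rpow_sub_one h1.ne', Real.rpow_sub ht, Real.rpow_two]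
  have h4 : t ^ α / (t + 1) ≤ (t + 1) ^ α / (t + 1) := by gcongr
  have h5 : t ^ α / t - t ^ α / (t + 1) ≤ t ^ α / t ^ 2 := by
    rw [← mul_one_div, ← mul_one_div (t ^ α) (t + 1), ← mul_one_div (t ^ α) (t ^ 2), ← mul_sub]
    gcongr
    rw [div_sub_div _ _ ht.ne' h1.ne', div_le_div_iff₀ (by positivity) (by positivity)]
    nlinarith
  linarith

/-- Both terms have the same sign here and nearly cancel, gaining one power of decay. The factor
`2^(2-α)` comes from `z - 1 ≥ z/2` on the positive side. -/
theorem abs_fAlpha_le_of_two_le {α z : ℝ} (hα : α ∈ Ioo (0 : ℝ) 1) (hz : 2 ≤ |z|) :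
    |fAlpha α z| ≤ |fracConst 1 (-α)| * 2 ^ (2 - α) * |z| ^ (α - 2) := by
  have hα1 := hα.1
  have hα2 := hα.2
  rw [fAlpha_eq, abs_mul, mul_assoc]
  gcongr
  rcases le_abs.1 hz with h | h
  · have e : |oddPow α z - oddPow α (z - 1)| = (z - 1) ^ (α - 1) - (z - 1 + 1) ^ (α - 1) := by
      unfold oddPow
      rw [Real.sign_of_pos (by linarith), Real.sign_of_pos (by linarith),
        abs_of_pos (by linarith : 0 < z), abs_of_pos (by linarith : 0 < z - 1), abs_sub_comm,
        mul_one, mul_one, sub_add_cancel, abs_of_nonneg]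
      exact sub_nonneg.2 (Real.rpow_le_rpow_of_nonpos (by linarith) (by linarith) (by linarith))
    rw [e]
    refine (rpow_sub_rpow_add_one_le hα1.le (by linarith)).trans ?_
    rw [abs_of_pos (by linarith : 0 < z), show (2 : ℝ) - α = -(α - 2) by ring,
      Real.rpow_neg two_pos.le,
      ← div_eq_inv_mul, ← Real.div_rpow (by linarith) two_pos.le]
    exact Real.rpow_le_rpow_of_nonpos (by linarith) (by linarith) (by linarith)
  · have e : |oddPow α z - oddPow α (z - 1)| = (-z) ^ (α - 1) - (-z + 1) ^ (α - 1) := by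
      unfold oddPow
      rw [Real.sign_of_neg (by linarith), Real.sign_of_neg (by linarith),
        abs_of_neg (by linarith : z < 0), abs_of_neg (by linarith : z - 1 < 0), neg_sub,
        show 1 - z = -z + 1 by ring,
        show (-z) ^ (α - 1) * -1 - (-z + 1) ^ (α - 1) * -1 =
          -((-z) ^ (α - 1) - (-z + 1) ^ (α - 1)) by ring, abs_neg, abs_of_nonneg]
      exact sub_nonneg.2 (Real.rpow_le_rpow_of_nonpos (by linarith) (by linarith) (by linarith))
    rw [e, abs_of_neg (by linarith : z < 0)]
    refine (rpow_sub_rpow_add_one_le hα1.le (by linarith)).trans ?_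
    refine le_mul_of_one_le_left (Real.rpow_nonneg (by linarith) _) ?_
    exact Real.one_le_rpow one_le_two (by linarith)

/-- The weight used in the Hölder estimate of the convolution. -/
noncomputable def weight (σ z : ℝ) : ℝ := 1 + |z| ^ (-σ) + |z - 1| ^ (-σ)

theorem one_le_weight (σ z : ℝ) : 1 ≤ weight σ z := by
  unfold weight
  have : 0 ≤ |z| ^ (-σ) := by positivity
  have : 0 ≤ |z - 1| ^ (-σ) := by positivity
  linarith

@[fun_prop]
theorem measurable_weight (σ : ℝ) : Measurable (weight σ) := by
  unfold weight
  fun_prop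

/-- Since `1 - p ≤ 0`, a large weight helps: near each singularity it lowers the order from `(1-α)p`
to `(1-α)p - σ(p-1)`, and the hypothesis says that this is below one. Far away the weight is only
used through `weight ≥ 1`, because `(α-2)p < -1`. -/
theorem integrable_abs_fAlpha_rpow_mul_weight {α p σ : ℝ} (hα : α ∈ Ioo (0 : ℝ) 1) (hp : 1 ≤ p)
    (h : (1 - α) * p - σ * (p - 1) < 1) :
    Integrable fun z => |fAlpha α z| ^ p * weight σ z ^ (1 - p) := by
  set s := (α - 1) * p + σ * (p - 1) with hs
  set c := |fracConst 1 (-α)|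
  have hc : 0 ≤ c := abs_nonneg _
  have hp0 : 0 < p := by linarith
  have hfar : (α - 2) * p < -1 := by nlinarith [hα.2]
  have i1 := integrable_indicator_abs_rpow (s := s) (by linarith) 3
  have i2 := i1.comp_sub_right 1
  have i3 : Integrable (indicator {x : ℝ | 1 < |x|} fun x => |x| ^ ((α - 2) * p)) :=
    (integrableOn_abs_rpow_of_lt hfar one_pos).integrable_indicator
      (measurableSet_lt measurable_const measurable_norm)
  have hne : ∀ c : ℝ, ∀ᵐ y : ℝ, y ≠ c := fun c => compl_mem_ae_iff.2 (measure_singleton c)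
  refine (((i1.add i2).const_mul (c ^ p * 2 ^ (p - 1))).add
    (i3.const_mul ((c * 2 ^ (2 - α)) ^ p))).mono' (by fun_prop : Measurable
      fun z => |fAlpha α z| ^ p * weight σ z ^ (1 - p)).aestronglyMeasurable ?_
  filter_upwards [hne 0, hne 1] with z hz0 hz1
  have hw := one_le_weight σ z
  have hw0 : 0 < weight σ z := by linarith
  have z0 : 0 < |z| := abs_pos.2 hz0
  have z1 : 0 < |z - 1| := abs_pos.2 (sub_ne_zero.2 hz1)
  have hind : ∀ (S : Set ℝ) (q x : ℝ), 0 ≤ S.indicator (fun x => |x| ^ q) x := fun S q x =>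
    indicator_nonneg (fun _ _ => by positivity) _
  rw [Real.norm_of_nonneg (by positivity)]
  simp only [Pi.add_apply]
  rcases lt_or_ge |z| 2 with hz | hz
  · refine le_add_of_le_of_nonneg ?_ (mul_nonneg (by positivity) (hind _ _ _))
    have hz' := abs_lt.1 hz
    rw [indicator_of_mem (show z ∈ Icc (-3) 3 from ⟨by linarith, by linarith⟩),
      indicator_of_mem (show z - 1 ∈ Icc (-3) 3 from ⟨by linarith, by linarith⟩)]
    have hb : ∀ t, 0 < t → t ^ (-σ) ≤ weight σ z →
        (t ^ (α - 1)) ^ p * weight σ z ^ (1 - p) ≤ t ^ s := by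
      intro t ht htw
      calc (t ^ (α - 1)) ^ p * weight σ z ^ (1 - p)
          ≤ (t ^ (α - 1)) ^ p * (t ^ (-σ)) ^ (1 - p) := by
            refine mul_le_mul_of_nonneg_left ?_ (by positivity)
            exact Real.rpow_le_rpow_of_nonpos (by positivity) htw (by linarith)
        _ = t ^ s := by
            rw [← Real.rpow_mul ht.le, ← Real.rpow_mul ht.le, ← Real.rpow_add ht]
            congr 1
            rw [hs]
            ring
    have b1 := hb |z| z0 (by
      unfold weight
      have : 0 ≤ |z - 1| ^ (-σ) := by positivity
      linarith)
    have b2 := hb |z - 1| z1 (by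
      unfold weight
      have : 0 ≤ |z| ^ (-σ) := by positivity
      linarith)
    calc |fAlpha α z| ^ p * weight σ z ^ (1 - p)
        ≤ (c * (|z| ^ (α - 1) + |z - 1| ^ (α - 1))) ^ p * weight σ z ^ (1 - p) := by
          gcongr
          exact abs_fAlpha_le α z
      _ ≤ c ^ p * (2 ^ (p - 1) * ((|z| ^ (α - 1)) ^ p + (|z - 1| ^ (α - 1)) ^ p)) *
            weight σ z ^ (1 - p) := by
          rw [Real.mul_rpow hc (by positivity)]
          gcongr
          exact_mod_cast NNReal.rpow_add_le_mul_rpow_add_rpow ⟨|z| ^ (α - 1), by positivity⟩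
            ⟨|z - 1| ^ (α - 1), by positivity⟩ hp
      _ = c ^ p * 2 ^ (p - 1) * ((|z| ^ (α - 1)) ^ p * weight σ z ^ (1 - p) +
            (|z - 1| ^ (α - 1)) ^ p * weight σ z ^ (1 - p)) := by ring
      _ ≤ _ := by gcongr
  · refine le_add_of_nonneg_of_le (mul_nonneg (by positivity)
      (add_nonneg (hind _ _ _) (hind _ _ _))) ?_
    rw [indicator_of_mem (show z ∈ {x : ℝ | 1 < |x|} from by
      change 1 < |z|
      linarith), Real.rpow_mul z0.le, ← Real.mul_rpow (by positivity) (by positivity)]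
    refine (mul_le_of_le_one_right (by positivity)
      (Real.rpow_le_one_of_one_le_of_nonpos hw (by linarith))).trans ?_
    gcongr
    exact abs_fAlpha_le_of_two_le hα hz

theorem integrable_fAlpha {α : ℝ} (hα : α ∈ Ioo (0 : ℝ) 1) : Integrable (fAlpha α) := by
  have := integrable_abs_fAlpha_rpow_mul_weight (σ := 0) hα le_rfl (by linarith [hα.1])
  rw [← integrable_norm_iff (measurable_fAlpha α).aestronglyMeasurable]
  simpa using this

/-! ### Weighted Hölder inequality for convolutions, and potentials of measures with power growth -/

/-- Hölder applied to the splitting of `K` into `K w^((1-p)/p)` and `w^((p-1)/p)`. -/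
theorem lintegral_rpow_le_weighted {X : Type*} [MeasurableSpace X] (μ : Measure X) {p : ℝ}
    (hp : 1 ≤ p) {K w : X → ℝ≥0∞} (hK : AEMeasurable K μ) (hw : AEMeasurable w μ)
    (hw0 : ∀ x, w x ≠ 0) (hwt : ∀ x, w x ≠ ⊤) :
    (∫⁻ x, K x ∂μ) ^ p ≤ (∫⁻ x, w x ∂μ) ^ (p - 1) * ∫⁻ x, K x ^ p * w x ^ (1 - p) ∂μ := by
  rcases hp.eq_or_lt with rfl | hp1
  · simp
  have hp0 : 0 < p := by linarith
  have hpq : p.HolderConjugate (p / (p - 1)) := Real.HolderConjugate.conjExponent hp1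
  have h := ENNReal.lintegral_mul_le_Lp_mul_Lq μ hpq
    (hK.mul (hw.pow_const ((1 - p) / p))) (hw.pow_const ((p - 1) / p))
  have e1 : ∀ x, (K * fun x => w x ^ ((1 - p) / p)) x * w x ^ ((p - 1) / p) = K x := fun x => by
    simp only [Pi.mul_apply]
    rw [mul_assoc, ← ENNReal.rpow_add _ _ (hw0 x) (hwt x), ← add_div]
    simp
  have e2 : ∀ x, (K * fun x => w x ^ ((1 - p) / p)) x ^ p = K x ^ p * w x ^ (1 - p) := fun x => by
    simp only [Pi.mul_apply]
    rw [ENNReal.mul_rpow_of_nonneg _ _ hp0.le, ← ENNReal.rpow_mul, div_mul_cancel₀ _ hp0.ne']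
  have e3 : ∀ x, (w x ^ ((p - 1) / p)) ^ (p / (p - 1)) = w x := fun x => by
    rw [← ENNReal.rpow_mul, div_mul_div_cancel₀ hp0.ne', div_self (by linarith),
      ENNReal.rpow_one]
  simp only [Pi.mul_apply] at h e1 e2
  simp only [e1, e2, e3] at h
  calc (∫⁻ x, K x ∂μ) ^ p ≤ ((∫⁻ x, K x ^ p * w x ^ (1 - p) ∂μ) ^ (1 / p) *
        (∫⁻ x, w x ∂μ) ^ (1 / (p / (p - 1)))) ^ p := by gcongr
    _ = _ := by
      rw [ENNReal.mul_rpow_of_nonneg _ _ hp0.le, ← ENNReal.rpow_mul, ← ENNReal.rpow_mul,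
        one_div_mul_cancel hp0.ne', ENNReal.rpow_one, one_div_div, div_mul_cancel₀ _ hp0.ne',
        mul_comm]

/-- The first Hölder factor is bounded uniformly in `x`; on the second, Tonelli and translation
invariance decouple the kernel from `P`. -/
theorem lintegral_convolution_rpow_le {P : Measure ℝ} [IsFiniteMeasure P] {p : ℝ} (hp : 1 ≤ p)
    {K w : ℝ → ℝ≥0∞} (hK : Measurable K) (hw : Measurable w)
    (hw0 : ∀ x, w x ≠ 0) (hwt : ∀ x, w x ≠ ⊤) {A : ℝ≥0∞} (hA : ∀ x, ∫⁻ y, w (x - y) ∂P ≤ A) :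
    ∫⁻ x, (∫⁻ y, K (x - y) ∂P) ^ p ≤
      A ^ (p - 1) * ((∫⁻ z, K z ^ p * w z ^ (1 - p)) * P univ) := by
  have hG : Measurable fun z => K z ^ p * w z ^ (1 - p) := by fun_prop
  calc ∫⁻ x, (∫⁻ y, K (x - y) ∂P) ^ p
      ≤ ∫⁻ x, A ^ (p - 1) * ∫⁻ y, K (x - y) ^ p * w (x - y) ^ (1 - p) ∂P := by
        refine lintegral_mono fun x => ?_
        refine (lintegral_rpow_le_weighted P hp (by fun_prop : Measurable _).aemeasurable
          (by fun_prop : Measurable fun y => w (x - y)).aemeasurable (fun _ => hw0 _)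
          fun _ => hwt _).trans ?_
        gcongr
        exact hA x
    _ = A ^ (p - 1) * ∫⁻ y, (∫⁻ x, K (x - y) ^ p * w (x - y) ^ (1 - p)) ∂P := by
        rw [lintegral_const_mul, lintegral_lintegral_swap]
        · exact (by fun_prop : Measurable fun q : ℝ × ℝ =>
            K (q.1 - q.2) ^ p * w (q.1 - q.2) ^ (1 - p)).aemeasurable
        · exact (by fun_prop : Measurable fun q : ℝ × ℝ =>
            K (q.1 - q.2) ^ p * w (q.1 - q.2) ^ (1 - p)).lintegral_prod_right'
    _ = _ := by
        congr 1
        rw [← lintegral_const]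
        congr 1 with y
        exact lintegral_sub_right_eq_self (fun z => K z ^ p * w z ^ (1 - p)) y

/-- On the dyadic shell `2^(-n-1) < |x-y| ≤ 2^(-n)` the integrand is at most a multiple of `2^(nσ)`,
while the mass is at most a multiple of `2^(-nε)`. The sum is geometric with ratio `2^(σ-ε) < 1`. -/
theorem exists_lintegral_abs_rpow_neg_le {P : Measure ℝ} [IsFiniteMeasure P] {C ε σ : ℝ}
    (hσ : 0 ≤ σ) (hσε : σ < ε)
    (hP : ∀ x r : ℝ, 0 < r → P (Ioo (x - r) (x + r)) ≤ ENNReal.ofReal (C * r ^ ε)) :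
    ∃ A : ℝ≥0∞, A ≠ ⊤ ∧ ∀ x, ∫⁻ y, ENNReal.ofReal (|x - y| ^ (-σ)) ∂P ≤ A := by
  set θ : ℝ := 2 ^ (σ - ε)
  have hθ0 : 0 ≤ θ := by positivity
  have hθ1 : θ < 1 := Real.rpow_lt_one_of_one_lt_of_neg one_lt_two (by linarith)
  set a : ℕ → ℝ := fun n => ((1 / 2 : ℝ) ^ (n + 1)) ^ (-σ)
  -- The doubled radius makes the open interval contain the shell including its outer endpoint.
  set r : ℕ → ℝ := fun n => 2 * (1 / 2 : ℝ) ^ n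
  have har : ∀ n, a n * (C * r n ^ ε) = C * 2 ^ σ * 2 ^ ε * θ ^ n := by
    intro n
    have e1 : a n = 2 ^ σ * (2 ^ n) ^ σ := by
      simp only [a]
      rw [one_div, inv_pow, Real.inv_rpow (by positivity), Real.rpow_neg (by positivity), inv_inv,
        pow_succ', Real.mul_rpow (by positivity) (by positivity)]
    have e2 : r n ^ ε = 2 ^ ε * ((2 ^ n) ^ ε)⁻¹ := by
      simp only [r]
      rw [Real.mul_rpow (by positivity) (by positivity), one_div, inv_pow,
        Real.inv_rpow (by positivity)]
    have e3 : θ ^ n = (2 ^ n) ^ σ * (((2 : ℝ) ^ n) ^ ε)⁻¹ := by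
      simp only [θ]
      rw [Real.rpow_pow_comm two_pos.le, Real.rpow_sub (by positivity), div_eq_mul_inv]
    rw [e1, e2, e3]
    ring
  have hsum : Summable fun n => a n * (C * r n ^ ε) := by
    simp only [har]
    exact (summable_geometric_of_lt_one hθ0 hθ1).mul_left _
  refine ⟨P univ + ∑' n, ENNReal.ofReal (a n * (C * r n ^ ε)), ?_, fun x => ?_⟩
  · exact ENNReal.add_ne_top.2 ⟨measure_ne_top _ _, hsum.tsum_ofReal_ne_top⟩
  have hpt : ∀ y, ENNReal.ofReal (|x - y| ^ (-σ)) ≤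
      1 + ∑' n, (Ioo (x - r n) (x + r n)).indicator (fun _ => ENNReal.ofReal (a n)) y := by
    intro y
    rcases le_or_gt 1 |x - y| with h | h
    · refine le_add_right ?_
      rw [ENNReal.ofReal_le_one]
      exact Real.rpow_le_one_of_one_le_of_nonpos h (by linarith)
    -- At `y = x` the real power of zero is `0` or `1`, so this point is covered by the constant
    -- term.
    rcases (abs_nonneg (x - y)).eq_or_lt with h0 | h0
    · refine le_add_right ?_
      rw [← h0, ENNReal.ofReal_le_one]
      exact Real.zero_rpow_le_one _
    obtain ⟨n, hn1, hn2⟩ := exists_nat_pow_near_of_lt_one h0 h.le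
      (by norm_num : (0 : ℝ) < 1 / 2) (by norm_num)
    refine le_add_left ((?_ : _ ≤ _).trans (ENNReal.le_tsum n))
    have hpow : (0 : ℝ) < (1 / 2) ^ n := by positivity
    have hlt : |x - y| < r n := by simp only [r]; linarith
    rw [indicator_of_mem]
    · exact ENNReal.ofReal_le_ofReal
        (Real.rpow_le_rpow_of_nonpos (by positivity) hn1.le (by linarith))
    · rw [abs_lt] at hlt
      exact ⟨by linarith, by linarith⟩
  calc ∫⁻ y, ENNReal.ofReal (|x - y| ^ (-σ)) ∂P
      ≤ ∫⁻ y, 1 + ∑' n, (Ioo (x - r n) (x + r n)).indicator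
          (fun _ => ENNReal.ofReal (a n)) y ∂P := lintegral_mono hpt
    _ = P univ + ∑' n, ENNReal.ofReal (a n) * P (Ioo (x - r n) (x + r n)) := by
        rw [lintegral_add_left measurable_const, lintegral_one, lintegral_tsum fun n =>
          (measurable_const.indicator measurableSet_Ioo).aemeasurable]
        simp only [lintegral_indicator_const measurableSet_Ioo]
    _ ≤ _ := by
        gcongr with n
        rw [ENNReal.ofReal_mul (by positivity)]
        gcongr
        exact hP x _ (by positivity)

theorem lintegral_weight_le {P : Measure ℝ} {σ : ℝ} {A : ℝ≥0∞}
    (hA : ∀ x, ∫⁻ y, ENNReal.ofReal (|x - y| ^ (-σ)) ∂P ≤ A) (x : ℝ) :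
    ∫⁻ y, ENNReal.ofReal (weight σ (x - y)) ∂P ≤ P univ + A + A := by
  have e : ∀ y, ENNReal.ofReal (weight σ (x - y)) =
      1 + ENNReal.ofReal (|x - y| ^ (-σ)) + ENNReal.ofReal (|x - 1 - y| ^ (-σ)) := fun y => by
    rw [weight, ENNReal.ofReal_add (by positivity) (by positivity),
      ENNReal.ofReal_add (by positivity) (by positivity), ENNReal.ofReal_one, sub_right_comm]
  simp only [e]
  rw [lintegral_add_left (by fun_prop), lintegral_add_left (by fun_prop), lintegral_one]
  gcongr
  exacts [hA x, hA (x - 1)]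

/-! ### Integration against `ν`, and the fractional derivative of `u_α` -/

theorem vectorMeasure_integrable_iff {ν : SignedMeasure ℝ} {f : ℝ → ℝ} :
    ν.Integrable f ↔ Integrable f ν.totalVariation := by
  rw [SignedMeasure.totalVariation_eq_variation]

/-- The Jordan decomposition reduces the vector-measure integral to Bochner integrals, where Fubini
can be applied to each part. -/
theorem integral_signedMeasure_eq {ν : SignedMeasure ℝ} {f : ℝ → ℝ}
    (hf : Integrable f ν.totalVariation) :
    ∫ᵛ x, f x ∂•ν = ∫ x, f x ∂ν.toJordanDecomposition.posPart -
      ∫ x, f x ∂ν.toJordanDecomposition.negPart := by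
  -- Multiplication on `ℝ` is symmetric; the flipped pairing is the one that
  -- `VectorMeasure.integral_toSignedMeasure` matches.
  have hflip : (ContinuousLinearMap.lsmul ℝ ℝ : ℝ →L[ℝ] ℝ →L[ℝ] ℝ) =
      (ContinuousLinearMap.lsmul ℝ ℝ).flip := by
    ext; simp
  have hp : ν.toJordanDecomposition.posPart.toSignedMeasure.Integrable f := by
    rw [VectorMeasure.Integrable, Measure.variation_toSignedMeasure]
    exact hf.mono_measure (Measure.le_add_right le_rfl)
  have hn : ν.toJordanDecomposition.negPart.toSignedMeasure.Integrable f := by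
    rw [VectorMeasure.Integrable, Measure.variation_toSignedMeasure]
    exact hf.mono_measure (Measure.le_add_left le_rfl)
  conv_lhs => rw [← ν.toSignedMeasure_toJordanDecomposition]
  unfold JordanDecomposition.toSignedMeasure
  rw [VectorMeasure.integral_sub_vectorMeasure hp hn, hflip,
    VectorMeasure.integral_toSignedMeasure, VectorMeasure.integral_toSignedMeasure]

theorem integrable_comp_sub_prod {P : Measure ℝ} [IsFiniteMeasure P] {f : ℝ → ℝ}
    (hf : Integrable f) (hm : Measurable f) :
    Integrable (fun q : ℝ × ℝ => f (q.1 - q.2)) (volume.prod P) := by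
  rw [integrable_prod_iff' (by fun_prop : Measurable _).aestronglyMeasurable]
  constructor
  · exact ae_of_all _ fun y => hf.comp_sub_right y
  · simp only [integral_sub_right_eq_self (fun x => ‖f x‖)]
    exact integrable_const _

theorem ae_integrable_fAlpha_sub {α : ℝ} (hα : α ∈ Ioo (0 : ℝ) 1) (P : Measure ℝ)
    [IsFiniteMeasure P] : ∀ᵐ x : ℝ, Integrable (fun y => fAlpha α (x - y)) P :=
  (integrable_comp_sub_prod (integrable_fAlpha hα) (measurable_fAlpha α)).prod_right_ae

theorem uAlpha_ae_eq {α : ℝ} (hα : α ∈ Ioo (0 : ℝ) 1) (ν : SignedMeasure ℝ) :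
    uAlpha α ν =ᵐ[volume] fun x => ∫ y, fAlpha α (x - y) ∂ν.toJordanDecomposition.posPart -
      ∫ y, fAlpha α (x - y) ∂ν.toJordanDecomposition.negPart := by
  filter_upwards [ae_integrable_fAlpha_sub hα ν.totalVariation] with x hx
  exact integral_signedMeasure_eq hx

theorem measurable_integral_fAlpha_sub (α : ℝ) (P : Measure ℝ) [IsFiniteMeasure P] :
    Measurable fun x => ∫ y, fAlpha α (x - y) ∂P :=
  (by fun_prop : Measurable fun q : ℝ × ℝ =>
    fAlpha α (q.1 - q.2)).stronglyMeasurable.integral_prod_right'.measurable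

theorem aestronglyMeasurable_uAlpha {α : ℝ} (hα : α ∈ Ioo (0 : ℝ) 1) (ν : SignedMeasure ℝ) :
    AEStronglyMeasurable (uAlpha α ν) := by
  refine AEStronglyMeasurable.congr ?_ (uAlpha_ae_eq hα ν).symm
  exact ((measurable_integral_fAlpha_sub α _).sub
    (measurable_integral_fAlpha_sub α _)).aestronglyMeasurable

theorem integral_convolution_fAlpha_mul_fracDiv {α : ℝ} (hα : α ∈ Ioo (0 : ℝ) 1) {φ : ℝ → ℝ}
    (hφ : IsTestFunction φ) (P : Measure ℝ) [IsFiniteMeasure P] :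
    Integrable (fun x => (∫ y, fAlpha α (x - y) ∂P) * fracDiv α φ x) ∧
    ∫ x, (∫ y, fAlpha α (x - y) ∂P) * fracDiv α φ x = ∫ y, (φ (y + 1) - φ y) ∂P := by
  obtain ⟨C, hC⟩ := exists_abs_divKernel_le hα hφ
  have hm : Measurable (fracDiv α φ) :=
    (measurable_divKernel α hφ.contDiff.continuous.measurable).const_mul _
  have hI : Integrable (fun q : ℝ × ℝ => fAlpha α (q.1 - q.2) * fracDiv α φ q.1)
      (volume.prod P) := by
    refine (integrable_comp_sub_prod (integrable_fAlpha hα) (measurable_fAlpha α)).mul_bdd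
      (c := |fracConst 1 α| * C) (hm.comp measurable_fst).aestronglyMeasurable
      (ae_of_all _ fun q => ?_)
    rw [fracDiv_eq, norm_mul]
    exact mul_le_mul_of_nonneg_left (hC _) (norm_nonneg _)
  constructor
  · simpa only [integral_mul_const] using hI.integral_prod_left
  · simp only [← integral_mul_const]
    rw [integral_integral_swap hI]
    simp only [integral_fAlpha_sub_mul_fracDiv hα hφ]

theorem IsTestFunction.integrable {φ : ℝ → ℝ} (hφ : IsTestFunction φ) (P : Measure ℝ)
    [IsFiniteMeasure P] : Integrable φ P :=
  hφ.contDiff.continuous.integrable_of_hasCompactSupport hφ.hasCompactSupport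

theorem integral_uAlpha_mul_fracDiv {α : ℝ} (hα : α ∈ Ioo (0 : ℝ) 1) (ν : SignedMeasure ℝ)
    {φ : ℝ → ℝ} (hφ : IsTestFunction φ) :
    ∫ x, uAlpha α ν x * fracDiv α φ x = ∫ᵛ y, (φ (y + 1) - φ y) ∂•ν := by
  obtain ⟨i1, v1⟩ := integral_convolution_fAlpha_mul_fracDiv hα hφ ν.toJordanDecomposition.posPart
  obtain ⟨i2, v2⟩ := integral_convolution_fAlpha_mul_fracDiv hα hφ ν.toJordanDecomposition.negPart
  rw [integral_signedMeasure_eq (f := fun y => φ (y + 1) - φ y)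
      (((hφ.comp_add_right 1).integrable _).sub (hφ.integrable _)),
    ← v1, ← v2, ← integral_sub i1 i2]
  refine integral_congr_ae ?_
  filter_upwards [uAlpha_ae_eq hα ν] with x hx
  rw [hx]
  ring

theorem isFracDeriv_uAlpha {α : ℝ} (hα : α ∈ Ioo (0 : ℝ) 1) (ν : SignedMeasure ℝ) :
    IsFracDeriv α (uAlpha α ν) (ν - ν.map (fun y : ℝ => y + 1)) := by
  intro φ hφ
  have h0 : ν.Integrable φ := vectorMeasure_integrable_iff.2 (hφ.integrable _)
  have h1 : ν.Integrable fun y => φ (y + 1) :=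
    vectorMeasure_integrable_iff.2 ((hφ.comp_add_right 1).integrable _)
  have e := measurableEmbedding_addRight (1 : ℝ)
  rw [integral_uAlpha_mul_fracDiv hα ν hφ, VectorMeasure.integral_sub_vectorMeasure h0
    (e.integrable_map_vectorMeasure.2 h1), e.integral_map_vectorMeasure, neg_sub]
  exact VectorMeasure.integral_fun_sub h1 h0

/-- The pairing with `div^α φ` is the integral against `ν` of a difference of two values of `φ`,
hence of a function bounded by `2`. -/
theorem fracVariation_uAlpha_lt_top {α : ℝ} (hα : α ∈ Ioo (0 : ℝ) 1) (ν : SignedMeasure ℝ) :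
    fracVariation α (uAlpha α ν) < ⊤ := by
  have : IsFiniteMeasure ν.variation := by
    rw [← SignedMeasure.totalVariation_eq_variation]
    infer_instance
  refine lt_of_le_of_lt (iSup_le (a := ((2 * ‖(ContinuousLinearMap.lsmul ℝ ℝ :
    ℝ →L[ℝ] ℝ →L[ℝ] ℝ)‖ * ν.variation.real univ : ℝ) : EReal)) fun φ => ?_) (EReal.coe_lt_top _)
  rw [EReal.coe_le_coe_iff, integral_uAlpha_mul_fracDiv hα ν φ.2.1]
  refine (Real.le_norm_self _).trans (VectorMeasure.norm_integral_le_of_norm_le_const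
    (ae_of_all _ fun y => ?_))
  refine (norm_sub_le _ _).trans ?_
  have h1 := φ.2.2 (y + 1)
  have h2 := φ.2.2 y
  simp only [Real.norm_eq_abs]
  linarith

/-! ### Integrability of `u_α` -/

theorem enorm_uAlpha_le (α : ℝ) (ν : SignedMeasure ℝ) (x : ℝ) :
    ‖uAlpha α ν x‖ₑ ≤ ∫⁻ y, ‖fAlpha α (x - y)‖ₑ ∂ν.totalVariation := by
  rw [SignedMeasure.totalVariation_eq_variation]
  refine VectorMeasure.enorm_integral_le_lintegral_enorm.trans ?_
  refine mul_le_of_le_one_left zero_le ?_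
  rw [← ofReal_norm, ENNReal.ofReal_le_one]
  exact ContinuousLinearMap.opNorm_lsmul_le

theorem memLp_uAlpha {α σ : ℝ} (hα : α ∈ Ioo (0 : ℝ) 1) {ν : SignedMeasure ℝ} {p : ℝ≥0∞}
    (hp : 1 ≤ p) (hpt : p ≠ ⊤) (h : (1 - α) * p.toReal - σ * (p.toReal - 1) < 1) {A : ℝ≥0∞}
    (hAt : A ≠ ⊤) (hA : ∀ x, ∫⁻ y, ENNReal.ofReal (|x - y| ^ (-σ)) ∂ν.totalVariation ≤ A) :
    MemLp (uAlpha α ν) p := by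
  have hp1 : 1 ≤ p.toReal := by
    rw [← ENNReal.toReal_one]
    exact ENNReal.toReal_mono hpt hp
  refine ⟨aestronglyMeasurable_uAlpha hα ν, ?_⟩
  rw [eLpNorm_lt_top_iff_lintegral_rpow_enorm_lt_top (one_pos.trans_le hp).ne' hpt]
  refine lt_of_le_of_lt (lintegral_mono fun x => ENNReal.rpow_le_rpow (enorm_uAlpha_le α ν x)
    (by linarith)) ?_
  have hw : ∀ z, 0 < weight σ z := fun z => one_pos.trans_le (one_le_weight σ z)
  refine (lintegral_convolution_rpow_le (K := fun z => ‖fAlpha α z‖ₑ)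
    (w := fun z => ENNReal.ofReal (weight σ z)) hp1 (by fun_prop) (by fun_prop)
    (fun z => (ENNReal.ofReal_pos.2 (hw z)).ne') (fun _ => ENNReal.ofReal_ne_top)
    (lintegral_weight_le hA)).trans_lt ?_
  refine ENNReal.mul_lt_top (ENNReal.rpow_lt_top_of_nonneg (by linarith) ?_)
    (ENNReal.mul_lt_top ?_ (measure_lt_top _ _))
  · simp [hAt]
  · have hi := (integrable_abs_fAlpha_rpow_mul_weight hα hp1 h).lintegral_lt_top
    convert hi using 3 with z
    rw [ENNReal.ofReal_mul (by positivity), ← ENNReal.ofReal_rpow_of_nonneg (abs_nonneg _)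
      (by linarith), ENNReal.ofReal_rpow_of_pos (hw z), ← Real.norm_eq_abs, ofReal_norm]

/-- With `σ = 1 - α` the weight itself dominates `f_α` up to a constant, so no Hölder step is
needed. -/
theorem memLp_top_uAlpha {α : ℝ} (hα : α ∈ Ioo (0 : ℝ) 1) {ν : SignedMeasure ℝ} {A : ℝ≥0∞}
    (hAt : A ≠ ⊤) (hA : ∀ x, ∫⁻ y, ENNReal.ofReal (|x - y| ^ (-(1 - α))) ∂ν.totalVariation ≤ A) :
    MemLp (uAlpha α ν) ⊤ := by
  refine ⟨aestronglyMeasurable_uAlpha hα ν, ?_⟩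
  rw [eLpNorm_exponent_top]
  set c := ENNReal.ofReal |fracConst 1 (-α)|
  refine (eLpNormEssSup_le_of_ae_enorm_bound (C := c * (ν.totalVariation univ + A + A))
    (ae_of_all _ fun x => ?_)).trans_lt (ENNReal.mul_lt_top ENNReal.ofReal_lt_top ?_)
  · refine (enorm_uAlpha_le α ν x).trans ?_
    calc ∫⁻ y, ‖fAlpha α (x - y)‖ₑ ∂ν.totalVariation
        ≤ ∫⁻ y, c * ENNReal.ofReal (weight (1 - α) (x - y)) ∂ν.totalVariation := by
          refine lintegral_mono fun y => ?_
          rw [← ofReal_norm, ← ENNReal.ofReal_mul (abs_nonneg _)]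
          refine ENNReal.ofReal_le_ofReal ((abs_fAlpha_le α _).trans ?_)
          rw [weight, neg_sub]
          gcongr
          linarith
      _ ≤ _ := by
          rw [lintegral_const_mul _ (by fun_prop)]
          gcongr
          exact lintegral_weight_le hA x
  · simp [hAt, lt_top_iff_ne_top]

/-- The potential bound needs `σ < ε` strictly, but the inequality on exponents is open in `σ`, so
it survives for some `σ` slightly below `ε`. -/
theorem memLp_uAlpha_of_growth {α C ε : ℝ} (hα : α ∈ Ioo (0 : ℝ) 1) {ν : SignedMeasure ℝ}
    {p : ℝ≥0∞} (hp : 1 ≤ p) (hpt : p ≠ ⊤) (hε : 0 < ε)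
    (hν : ∀ x r : ℝ, 0 < r →
      ν.totalVariation (Ioo (x - r) (x + r)) ≤ ENNReal.ofReal (C * r ^ ε))
    (h : (1 - α) * p.toReal - ε * (p.toReal - 1) < 1) : MemLp (uAlpha α ν) p := by
  have hp1 : 1 ≤ p.toReal := by
    rw [← ENNReal.toReal_one]
    exact ENNReal.toReal_mono hpt hp
  have hev : ∀ᶠ σ in 𝓝[<] ε, (1 - α) * p.toReal - σ * (p.toReal - 1) < 1 :=
    nhdsWithin_le_nhds ((by fun_prop : Continuous fun σ : ℝ =>
      (1 - α) * p.toReal - σ * (p.toReal - 1)).tendsto ε |>.eventually_lt_const h)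
  obtain ⟨σ, hσ, hσ0, hσε⟩ := (hev.and (Ioo_mem_nhdsLT hε)).exists
  obtain ⟨A, hAt, hA⟩ := exists_lintegral_abs_rpow_neg_le hσ0.le hσε hν
  exact memLp_uAlpha hα hp hpt hσ hAt hA

end FracBV

theorem mainTheorem11 (α : ℝ) (hα : α ∈ Set.Ioo (0 : ℝ) 1) (ν : SignedMeasure ℝ) :
    -- `D^α f_α = δ₀ - δ₁`
    FracBV.IsFracDeriv α (FracBV.fAlpha α)
      (VectorMeasure.dirac (0 : ℝ) (1 : ℝ) - VectorMeasure.dirac (1 : ℝ) (1 : ℝ)) ∧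
    -- the convolution integral defining `u_α(x)` converges absolutely for almost every `x`
    (∀ᵐ x : ℝ, Integrable (fun y => FracBV.fAlpha α (x - y)) ν.totalVariation) ∧
    (∀ p : ℝ≥0∞, 1 ≤ p → p < ENNReal.ofReal (1 / (1 - α)) →
      FracBV.MemBV α p (FracBV.uAlpha α ν)) ∧
    FracBV.IsFracDeriv α (FracBV.uAlpha α ν) (ν - ν.map (fun y : ℝ => y + 1)) ∧
    (∀ C ε : ℝ, 0 < C → 0 < ε →
      (∀ x r : ℝ, 0 < r →
        ν.totalVariation (Set.Ioo (x - r) (x + r)) ≤ ENNReal.ofReal (C * r ^ ε)) →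
      (ε < 1 - α → ∀ p : ℝ≥0∞, 1 ≤ p →
        p < ENNReal.ofReal ((1 - ε) / (1 - α - ε)) →
          FracBV.MemBV α p (FracBV.uAlpha α ν)) ∧
      (ε = 1 - α → ∀ p : ℝ≥0∞, 1 ≤ p → p < ⊤ → FracBV.MemBV α p (FracBV.uAlpha α ν)) ∧
      (1 - α < ε → ε ≤ 1 → ∀ p : ℝ≥0∞, 1 ≤ p →
        FracBV.MemBV α p (FracBV.uAlpha α ν))) := by
  have hα0 := hα.1
  have hα1 := hα.2
  have hvar := FracBV.fracVariation_uAlpha_lt_top hα ν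
  refine ⟨fun φ hφ => ?_, FracBV.ae_integrable_fAlpha_sub hα _, fun p hp hp' => ⟨?_, hvar⟩,
    FracBV.isFracDeriv_uAlpha hα ν, fun C ε _ hε hν => ⟨fun h p hp hp' => ⟨?_, hvar⟩,
    fun h p hp hp' => ⟨?_, hvar⟩, fun h _ p hp => ⟨?_, hvar⟩⟩⟩
  · have hi : ∀ a : ℝ, (VectorMeasure.dirac a (1 : ℝ)).Integrable φ := fun a => by
      rw [VectorMeasure.Integrable, VectorMeasure.variation_dirac, enorm_one, one_smul]
      exact hφ.integrable _
    rw [VectorMeasure.integral_sub_vectorMeasure (hi 0) (hi 1), VectorMeasure.integral_dirac,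
      VectorMeasure.integral_dirac]
    have := FracBV.integral_fAlpha_sub_mul_fracDiv hα hφ 0
    simpa using this
  · have hpt := (hp'.trans ENNReal.ofReal_lt_top).ne
    -- For `σ = 0` the potential is just the total mass of `|ν|`, and the exponent condition reads
    -- `(1-α)p < 1`.
    refine FracBV.memLp_uAlpha (σ := 0) (A := ν.totalVariation Set.univ) hα hp hpt ?_
      (measure_ne_top _ _) (fun x => by simp)
    rw [← ENNReal.ofReal_toReal hpt, ENNReal.ofReal_lt_ofReal_iff_of_nonneg ENNReal.toReal_nonneg,
      lt_div_iff₀ (by linarith)] at hp'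
    linarith
  · have hpt := (hp'.trans ENNReal.ofReal_lt_top).ne
    refine FracBV.memLp_uAlpha_of_growth hα hp hpt hε hν ?_
    rw [← ENNReal.ofReal_toReal hpt, ENNReal.ofReal_lt_ofReal_iff_of_nonneg ENNReal.toReal_nonneg,
      lt_div_iff₀ (by linarith)] at hp'
    linarith
  -- When `ε = 1 - α` the dependence on `p` drops out and the exponent condition becomes `1 - α <
  -- 1`.
  · refine FracBV.memLp_uAlpha_of_growth hα hp hp'.ne hε hν ?_
    rw [h]
    linarith
  · rcases eq_or_ne p ⊤ with rfl | hpt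
    · obtain ⟨A, hAt, hA⟩ :=
        FracBV.exists_lintegral_abs_rpow_neg_le (by linarith : 0 ≤ 1 - α) h hν
      exact FracBV.memLp_top_uAlpha hα hAt hA
    · refine FracBV.memLp_uAlpha_of_growth hα hp hpt hε hν ?_
      have hp1 : 1 ≤ p.toReal := by
        rw [← ENNReal.toReal_one]
        exact ENNReal.toReal_mono hpt hp
      -- The left side equals `(1 - α) + (1 - α - ε)(p - 1)`, and the second term is nonpositive.
      nlinarith
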